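/- Let $G=(V,E)$ be a tree with a finite vertex set $V$, $|V|\ge 2$. For each $v\in V$ let $\mathcal I_v$ be a finite set, and put $\mathcal I=\prod_{v\in V}\mathcal I_v$ and $\mathcal I_D=\prod_{v\in D}\mathcal I_v$ for $D\subset V$; write $\underline i_D$ for the restriction of $\underline i\in\mathcal I$ to $D$. For a table $q$ on $\mathcal I$ let $q^D_{\underline k}=\sum_{\underline i:\,\underline i_D=\underline k}q(\underline i)$ be its $D$-marginal. Let $C_1,\dots,C_K$ be the cliques (maximal complete subsets) of $G$ in a perfect order, that is, with $S_1=\emptyset$ and $S_j=C_j\cap(C_1\cup\dots\cup C_{j-1})$, for every $j>1$ there is $i<j$ with $S_j\subset C_i$. Let ${\bf p}=({\bf p}(\underline i),\,\underline i\in\mathcal I)$ be a random vector, almost surely with positive entries that sum to $1$, which is associated with $G$: almost surely, for all $\underline i\in\mathcal I$, $${\bf p}(\underline i)=\frac{\prod_{l=1}^K{\bf p}^{C_l}_{\underline i_{C_l}}}{\prod_{l=2}^K{\bf p}^{S_l}_{\underline i_{S_l}}}.$$ Write $\mathbb P_{\bf p}$ for probabilities computed for a random vector ${\bf X}=(X_v)_{v\in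 V}$ with $\mathbb P_{\bf p}({\bf X}=\underline i)={\bf p}(\underline i)$. For $v\in V$ let $\mathcal G_v$ be the directed acyclic graph obtained from $G$ by directing all edges away from $v$, and let $\mathfrak p_w$ be the set of parents of $w$ in it (it is empty for $w=v$ and has exactly one element otherwise). Parameter independence with respect to $\mathcal G_v$ means that the random vectors $$\big(\mathbb P_{\bf p}(X_w=l\mid {\bf X}_{\mathfrak p_w}=\underline k),\ l\in\mathcal I_w\big),\qquad \underline k\in\mathcal I_{\mathfrak p_w},\ w\in V,$$ are mutually independent and that each of them is non-degenerate (not almost surely constant). Assume that for every leaf $v$ of $G$ (vertex of degree one) parameter independence with respect to $\mathcal G_v$ holds. Then ${\bf p}$ follows a hyper Dirichlet distribution with respect to $G$: there are numbers $\alpha^{C_l}_{\underline k}>0$ ($\underline k\in\mathcal I_{C_l}$) and $\alpha^{S_l}_{\underline n}$ ($\underline n\in\mathcal I_{S_l}$), $l=1,\dots,K$, with $$\sum_{\underline k\in\mathcal I_{C_m}:\,\underline k_{S_l}=\underline n}\alpha^{C_m}_{\underline k}=\alpha^{S_l}_{\underline n}\qquad\text{whenever } S_l\subset C_m,\ \underline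 n\in\mathcal I_{S_l}$$ (for $S_1=\emptyset$ this says that each $\alpha^{C_m}$ has the same total $\alpha=\alpha^{\emptyset}$), such that for all tables $\underline r=(r(\underline i),\,\underline i\in\mathcal I)$ of non-negative integers $$\mathbb E\prod_{\underline i\in\mathcal I}{\bf p}(\underline i)^{r(\underline i)}=\frac{\mathcal Z(\alpha+r)}{\mathcal Z(\alpha)},\qquad \mathcal Z(\alpha)=\frac{\prod_{l=1}^K\prod_{\underline k\in\mathcal I_{C_l}}\Gamma(\alpha^{C_l}_{\underline k})}{\Gamma(\alpha)\prod_{l=2}^K\prod_{\underline n\in\mathcal I_{S_l}}\Gamma(\alpha^{S_l}_{\underline n})},$$ where $\alpha+r$ is obtained by adding to each $\alpha^D_{\underline k}$ the marginal count $r^D_{\underline k}$. (As ${\bf p}$ takes values in the simplex, these moments determine its distribution.) -/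

import Mathlib

open MeasureTheory ProbabilityTheory

namespace GraphDirichlet

variable {V : Type*} [Fintype V] [DecidableEq V]
variable {I : V → Type*} [∀ v, Fintype (I v)] [∀ v, DecidableEq (I v)]

/-- The `D`-marginal of a table `q` on the cells `∏ v, I v`: the sum of `q i` over all the cells `i`
with `i_D = k`. It is used for probability tables (real entries) and for count tables. -/
def marginal {M : Type*} [AddCommMonoid M] (q : (∀ v, I v) → M) (D : Finset V)
    (k : ∀ u : D, I u) : M :=
  ∑ i with D.restrict i = k, q i

/-- The conditional probability `ℙ(X_v = l | X_D = k)` when `X` has the probability table `q`. -/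
noncomputable def condProb (q : (∀ v, I v) → ℝ) (v : V) (D : Finset V) (k : ∀ u : D, I u)
    (l : I v) : ℝ :=
  (∑ i with D.restrict i = k ∧ i v = l, q i) / marginal q D k

/-- The separator `S_j = C_j ∩ (⋃_{i < j} C_i)`; the first one is empty. -/
def separator {K : ℕ} (C : Fin K → Finset V) (j : Fin K) : Finset V :=
  C j ∩ (Finset.Iio j).biUnion C

/-- `C` lists the cliques (the maximal complete subsets) of `G`, each of them once,
in a perfect order. -/
structure IsPerfectOrder (G : SimpleGraph V) {K : ℕ} (C : Fin K → Finset V) : Prop where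
  injective : Function.Injective C
  mem_range_iff : ∀ D : Finset V,
    D ∈ Set.range C ↔ Maximal (fun s : Finset V => G.IsClique (s : Set V)) D
  perfect : ∀ j : Fin K, 0 < (j : ℕ) → ∃ i < j, separator C j ⊆ C i

variable {Ω : Type*} [MeasurableSpace Ω]

/-- `p` is a vector of random cell probabilities: almost surely its entries are positive
and sum to one. -/
structure IsRandomProbabilities (μ : Measure Ω) (p : Ω → (∀ v, I v) → ℝ) : Prop where
  measurable : Measurable p
  pos : ∀ᵐ ω ∂μ, ∀ i, 0 < p ω i
  sum_eq_one : ∀ᵐ ω ∂μ, ∑ i, p ω i = 1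

/-- `p` is a vector of random cell probabilities associated with `G`: it factorizes over the cliques
and the separators of `G`, the separators being counted with their multiplicity in a perfect order.
The factor of the first separator, which is empty, is `∑ i, p ω i = 1`. -/
def IsAssociated (G : SimpleGraph V) (μ : Measure Ω) (p : Ω → (∀ v, I v) → ℝ) : Prop :=
  IsRandomProbabilities μ p ∧
    ∃ (K : ℕ) (C : Fin K → Finset V), IsPerfectOrder G C ∧
      ∀ᵐ ω ∂μ, ∀ i : ∀ v, I v,
        p ω i = (∏ l, marginal (p ω) (C l) ((C l).restrict i)) /
          ∏ l, marginal (p ω) (separator C l) ((separator C l).restrict i)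

/-- Parameter independence (local and global) for `p` with respect to the directed acyclic graph
with parent function `𝔭`: the random vectors `(ℙ_p(X_v = l | X_{𝔭 v} = k), l ∈ I v)`, for `v : V` and
`k` a cell of `𝔭 v`, are mutually independent, and none of them is almost surely constant. -/
def ParameterIndependence (μ : Measure Ω) (p : Ω → (∀ v, I v) → ℝ) (𝔭 : V → Finset V) : Prop :=
  iIndepFun (fun (x : Σ v : V, (∀ u : 𝔭 v, I u)) (ω : Ω) (l : I x.1) =>
      condProb (p ω) x.1 (𝔭 x.1) x.2 l) μ ∧
    ∀ (v : V) (k : ∀ u : 𝔭 v, I u),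
      ¬ ∃ c : I v → ℝ, ∀ᵐ ω ∂μ, (fun l => condProb (p ω) v (𝔭 v) k l) = c

/-- The parent function of the directed acyclic graph obtained from a tree `G` by choosing the
root `r` and directing every edge away from `r`. -/
noncomputable def rootedParents (G : SimpleGraph V) [DecidableRel G.Adj] (r w : V) : Finset V :=
  {u | G.Adj u w ∧ G.dist r w = G.dist r u + 1}

/-- The normalizing constant of the hyper Dirichlet distribution. The factor `Γ(α)` of the total mass
is the one of the first separator, which is empty. -/
noncomputable def normConst {K : ℕ} (C : Fin K → Finset V)
    (α : ∀ D : Finset V, (∀ u : D, I u) → ℝ) : ℝ :=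
  (∏ l, ∏ k, Real.Gamma (α (C l) k)) / ∏ l, ∏ k, Real.Gamma (α (separator C l) k)

/-- `α` is a system of hyperparameters: positive on the clique cells, and consistent, in that
`α^S` is the `S`-marginal of `α^C` whenever the separator `S` (possibly empty) is contained in the
clique `C`. Only the values of `α` at cliques and separators matter. -/
structure IsHyperparameter {K : ℕ} (C : Fin K → Finset V)
    (α : ∀ D : Finset V, (∀ u : D, I u) → ℝ) : Prop where
  pos : ∀ l k, 0 < α (C l) k
  consistent : ∀ (l m : Fin K) (h : separator C l ⊆ C m) (s : ∀ u : separator C l, I u),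
    ∑ k with Finset.restrict₂ h k = s, α (C m) k = α (separator C l) s

/-- `p` is associated with `G` and follows a hyper Dirichlet distribution with respect to `G`.
As `p` takes its values in the simplex, its law is determined by its moments, and the
hyper Dirichlet distribution is given by its moments
`𝔼 ∏ i, p(i) ^ r(i) = Z(α + r) / Z(α)`, where `Z` is the normalizing constant and `α + r` stands for
the addition of the clique and separator marginals of `r`. -/
def FollowsHyperDirichlet (G : SimpleGraph V) (μ : Measure Ω) (p : Ω → (∀ v, I v) → ℝ) : Prop :=
  IsAssociated G μ p ∧
    ∃ (K : ℕ) (C : Fin K → Finset V), IsPerfectOrder G C ∧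
      ∃ α : ∀ D : Finset V, (∀ u : D, I u) → ℝ, IsHyperparameter C α ∧
        ∀ r : (∀ v, I v) → ℕ,
          ∫ ω, ∏ i, p ω i ^ r i ∂μ =
            normConst C (fun D k => α D k + ((marginal r D k : ℕ) : ℝ)) / normConst C α

end GraphDirichlet

/-
Independence of the parameters with respect to the rooting at a leaf makes the moments of the
marginal table of an edge `{u, w}` factorize into a function of the row totals and functions of the
single rows; a leaf beyond the other end of the edge gives the same for the columns. Moving a count
within a row and then within a column shows that the ratio of the moments at `n + e_t` and at `n`
depends only on `n t` and on the total of `n`. This is Johnson's sufficientness postulate, and as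
the table has more than two cells it forces the ratio to be `(m t + κ n t) / (1 + κ ∑ s, n s)` with
`κ ≥ 0` and `m` the mean: the moments are those of a Pólya urn. Non-degeneracy excludes `κ = 0`, so
that the edge table is Dirichlet of total mass `κ⁻¹`, and two edges with a common vertex have the
same `κ`, whence all of them do. The rows of a Dirichlet table are Dirichlet, and multiplying their
moments along the tree rooted at a leaf gives the hyper Dirichlet moments.
-/

namespace GraphDirichlet

section Polya

variable {T : Type*} [DecidableEq T]

lemma table_induction [Finite T] {P : (T → ℕ) → Prop} (zero : P 0)
    (add_single : ∀ n t, P n → P (n + Pi.single t 1)) (n : T → ℕ) : P n := by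
  have key (m : T → ℕ) : ∀ n, P n → P (n + m) := by
    refine Pi.single_induction (fun m : T → ℕ => ∀ n, P n → P (n + m)) m ?_ ?_ ?_
    · simp
    · intro f g hf hg n hn
      exact add_assoc n f g ▸ hg _ (hf n hn)
    · intro t k n hn
      induction k with
      | zero => simpa using hn
      | succ k ih => simpa only [Pi.single_add, ← add_assoc] using add_single _ t ih
  simpa using key n 0 zero

variable [Fintype T]

lemma sum_add_single_one (n : T → ℕ) (t : T) :
    ∑ s, (n + Pi.single t 1 : T → ℕ) s = (∑ s, n s) + 1 := by
  simp [Finset.sum_add_distrib]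

/-- The algebraic properties of the moments `M n = 𝔼 ∏ t, X t ^ n t` of a random vector `X` with
positive entries that sum to one. -/
structure IsSimplexMoments (M : (T → ℕ) → ℝ) : Prop where
  zero : M 0 = 1
  pos : ∀ n, 0 < M n
  sum_add_single : ∀ n, ∑ t, M (n + Pi.single t 1) = M n

/-- The recursion between the moments of a Pólya urn that starts with the weights `a` and in which
every draw reinforces the weight of the drawn colour by `κ`. For `κ > 0` it characterizes the
Dirichlet distribution with parameters `a / κ`, for `κ = 0` the point mass proportional to `a`. -/
def PolyaRecursion (κ : ℝ) (a : T → ℝ) (M : (T → ℕ) → ℝ) : Prop :=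
  ∀ n t, M (n + Pi.single t 1) * ∑ s, (a s + κ * n s) = M n * (a t + κ * n t)

/-- The moments of the Dirichlet distribution with parameters `α`. -/
noncomputable def dirichletMoment (α : T → ℝ) (n : T → ℕ) : ℝ :=
  (∏ t, Real.Gamma (α t + n t) / Real.Gamma (α t)) /
    (Real.Gamma (∑ t, (α t + n t)) / Real.Gamma (∑ t, α t))

lemma PolyaRecursion.eq_of_apply_zero_eq {κ : ℝ} {a : T → ℝ} {M M' : (T → ℕ) → ℝ}
    (h : PolyaRecursion κ a M) (h' : PolyaRecursion κ a M') (h0 : M 0 = M' 0)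
    (hne : ∀ n : T → ℕ, ∑ s, (a s + κ * n s) ≠ 0) : M = M' := by
  funext n
  induction n using table_induction with
  | zero => exact h0
  | add_single n t ih => exact mul_right_cancel₀ (hne n) (by rw [h, h', ih])

lemma PolyaRecursion.inv_mul {κ : ℝ} (hκ : κ ≠ 0) {a : T → ℝ} {M : (T → ℕ) → ℝ}
    (h : PolyaRecursion κ a M) : PolyaRecursion 1 (fun t => κ⁻¹ * a t) M := by
  have hscale (t : T) (m : ℕ) : κ⁻¹ * a t + 1 * m = κ⁻¹ * (a t + κ * m) := by field_simp
  intro n t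
  simp only [hscale, ← Finset.mul_sum]
  rw [mul_left_comm, h n t, mul_left_comm]

omit [DecidableEq T] in
lemma dirichletMoment_zero [Nonempty T] {α : T → ℝ} (hα : ∀ t, 0 < α t) :
    dirichletMoment α 0 = 1 := by
  have hΓ (t : T) : Real.Gamma (α t) ≠ 0 := (Real.Gamma_pos_of_pos (hα t)).ne'
  have hsum : 0 < ∑ t, α t := Finset.sum_pos (fun t _ => hα t) Finset.univ_nonempty
  simp [dirichletMoment, hΓ, (Real.Gamma_pos_of_pos hsum).ne']

lemma polyaRecursion_dirichletMoment [Nonempty T] {α : T → ℝ} (hα : ∀ t, 0 < α t) :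
    PolyaRecursion 1 α (dirichletMoment α) := by
  intro n t
  have hpos (s : T) : 0 < α s + n s := add_pos_of_pos_of_nonneg (hα s) (Nat.cast_nonneg _)
  have hsum : 0 < ∑ s, (α s + n s) := Finset.sum_pos (fun s _ => hpos s) Finset.univ_nonempty
  have hnum : ∏ s, Real.Gamma (α s + (n + Pi.single t 1 : T → ℕ) s) / Real.Gamma (α s) =
      (α t + n t) * ∏ s, Real.Gamma (α s + n s) / Real.Gamma (α s) := by
    rw [← Finset.mul_prod_erase _ _ (Finset.mem_univ t), ← Finset.mul_prod_erase _ (fun s =>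
      Real.Gamma (α s + n s) / Real.Gamma (α s)) (Finset.mem_univ t), ← mul_assoc]
    congr 1
    · simp [← add_assoc, Real.Gamma_add_one (hpos t).ne', mul_div_assoc]
    · refine Finset.prod_congr rfl fun s hs => ?_
      simp [Finset.ne_of_mem_erase hs]
  have hden : ∑ s, (α s + (n + Pi.single t 1 : T → ℕ) s) = ∑ s, (α s + n s) + 1 := by
    simp only [Finset.sum_add_distrib, ← Nat.cast_sum, sum_add_single_one]
    push_cast
    ring
  have hΓ : Real.Gamma (∑ s, (α s + n s)) ≠ 0 := (Real.Gamma_pos_of_pos hsum).ne'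
  simp only [dirichletMoment, one_mul, hnum, hden, Real.Gamma_add_one hsum.ne']
  field_simp

lemma PolyaRecursion.eq_dirichletMoment [Nonempty T] {κ : ℝ} (hκ : 0 < κ) {a : T → ℝ}
    (ha : ∀ t, 0 < a t) {M : (T → ℕ) → ℝ} (h : PolyaRecursion κ a M) (h0 : M 0 = 1) :
    M = dirichletMoment fun t => κ⁻¹ * a t := by
  have hα (t : T) : 0 < κ⁻¹ * a t := mul_pos (inv_pos.2 hκ) (ha t)
  refine (h.inv_mul hκ.ne').eq_of_apply_zero_eq (polyaRecursion_dirichletMoment hα)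
    (h0.trans (dirichletMoment_zero hα).symm) fun n => (Finset.sum_pos ?_ ?_).ne'
  · exact fun t _ => add_pos_of_pos_of_nonneg (hα t) (by positivity)
  · exact Finset.univ_nonempty

lemma IsSimplexMoments.apply_add_single_lt [Nontrivial T] {M : (T → ℕ) → ℝ}
    (hM : IsSimplexMoments M) (n : T → ℕ) (t : T) : M (n + Pi.single t 1) < M n := by
  obtain ⟨s, hs⟩ := exists_ne t
  rw [← hM.sum_add_single n]
  exact Finset.single_lt_sum (f := fun s => M (n + Pi.single s 1)) hs (Finset.mem_univ t)
    (Finset.mem_univ s) (hM.pos _) fun _ _ _ => (hM.pos _).le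

/-- Comparing the two recursions at a second draw of the same colour `t`, the reinforcements can
only differ if that second draw is certain. -/
lemma PolyaRecursion.reinforcement_unique [Nontrivial T] {κ κ' : ℝ} {a : T → ℝ}
    {M : (T → ℕ) → ℝ} (hM : IsSimplexMoments M) (h : PolyaRecursion κ a M)
    (h' : PolyaRecursion κ' a M) : κ = κ' := by
  obtain ⟨t⟩ : Nonempty T := inferInstance
  have hdiff : (κ - κ') * (M (Pi.single t 1 + Pi.single t 1) - M (Pi.single t 1)) = 0 := by
    have e := h (Pi.single t 1) t
    have e' := h' (Pi.single t 1) t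
    simp only [Finset.sum_add_distrib, ← Finset.mul_sum, ← Nat.cast_sum, Finset.sum_pi_single',
      Finset.mem_univ, if_true, Pi.single_eq_same, Nat.cast_one, mul_one] at e e'
    linear_combination e - e'
  have hlt := hM.apply_add_single_lt (Pi.single t 1) t
  exact sub_eq_zero.1 ((mul_eq_zero.1 hdiff).resolve_right (sub_neg.2 hlt).ne)

end Polya

section Johnson

variable {T : Type*}

lemma exists_forall_eq_of_apply_eq_of_add_le (hT : 3 ≤ ENat.card T) {β : Type*} {N : ℕ}
    {f : T → ℕ → β}
    (hf : ∀ ⦃a b⦄, a ≠ b → ∀ ⦃x y⦄, x + y ≤ N → f a x = f b y) :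
    ∃ c, ∀ a, ∀ x ≤ N, f a x = c := by
  obtain ⟨t⟩ : Nonempty T := (ENat.card_pos_iff_nonempty T).1 (hT.trans_lt' (by norm_num))
  refine ⟨f t 0, fun a x hx => ?_⟩
  obtain ⟨b, hba, hbt⟩ := ENat.exists_ne_ne_of_three_le hT a t
  exact (hf hba.symm (y := 0) hx).trans (hf hbt (Nat.zero_le N))

lemma exists_table_apply_eq [Fintype T] (hT : 3 ≤ ENat.card T) {a b : T} (hab : a ≠ b) {x y N : ℕ}
    (h : x + y ≤ N) : ∃ n : T → ℕ, n a = x ∧ n b = y ∧ ∑ t, n t = N := by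
  classical
  obtain ⟨c, hca, hcb⟩ := ENat.exists_ne_ne_of_three_le hT a b
  refine ⟨Pi.single a x + Pi.single b y + Pi.single c (N - (x + y)), ?_, ?_, ?_⟩
  · simp [hab, hca.symm]
  · simp [hab.symm, hcb.symm]
  · simpa [Finset.sum_add_distrib] using Nat.add_sub_cancel' h

variable [Fintype T] [DecidableEq T] {M : (T → ℕ) → ℝ} {g : T → ℕ → ℕ → ℝ}

/-- Johnson's sufficientness postulate: the predictive probability `M (n + e_t) / M n` of a draw of
colour `t` after the counts `n` depends only on `t`, on the count `n t` and on the total count. -/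
def JohnsonSufficient (M : (T → ℕ) → ℝ) : Prop :=
  ∃ g : T → ℕ → ℕ → ℝ, ∀ n t, M (n + Pi.single t 1) = M n * g t (n t) (∑ s, n s)

section Predictive

variable (hT : 3 ≤ ENat.card T) (hM : IsSimplexMoments M)
  (hg : ∀ n t, M (n + Pi.single t 1) = M n * g t (n t) (∑ s, n s))

include hM hg

lemma sum_predictive (n : T → ℕ) : ∑ t, g t (n t) (∑ s, n s) = 1 := by
  have h := hM.sum_add_single n
  simp only [hg, ← Finset.mul_sum] at h
  exact (mul_eq_left₀ (hM.pos n).ne').1 h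

include hT

lemma predictive_pos (a : T) {x N : ℕ} (hx : x ≤ N) : 0 < g a x N := by
  obtain ⟨b, hba, -⟩ := ENat.exists_ne_ne_of_three_le hT a a
  obtain ⟨n, rfl, -, rfl⟩ := exists_table_apply_eq hT hba.symm (y := 0) hx
  exact (mul_pos_iff_of_pos_left (hM.pos n)).1 (hg n a ▸ hM.pos _)

/-- Moving one count from `b` to `a` changes only two of the predictive probabilities, which sum
to one. -/
lemma predictive_sub_eq {a b : T} (hab : a ≠ b) {x y N : ℕ} (h : x + y ≤ N) :
    g a (x + 1) (N + 1) - g a x (N + 1) = g b (y + 1) (N + 1) - g b y (N + 1) := by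
  obtain ⟨n, rfl, rfl, rfl⟩ := exists_table_apply_eq hT hab h
  have hsum := (sum_predictive hM hg (n + Pi.single a 1)).trans
    (sum_predictive hM hg (n + Pi.single b 1)).symm
  simp only [sum_add_single_one] at hsum
  rw [← sub_eq_zero, ← Finset.sum_sub_distrib, Fintype.sum_eq_add a b hab] at hsum
  · simp only [Pi.add_apply, Pi.single_eq_same, Pi.single_eq_of_ne hab, Pi.single_eq_of_ne hab.symm,
      add_zero] at hsum
    linear_combination hsum
  · rintro t ⟨hta, htb⟩
    simp [hta, htb]

/-- Both sides come from drawing `a` and `b` in the two possible orders. -/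
lemma predictive_div_eq {a b : T} (hab : a ≠ b) {x y N : ℕ} (h : x + y ≤ N) :
    g a x (N + 1) / g a x N = g b y (N + 1) / g b y N := by
  rw [div_eq_div_iff (predictive_pos hT hM hg a (by lia)).ne'
    (predictive_pos hT hM hg b (by lia)).ne']
  obtain ⟨n, rfl, rfl, rfl⟩ := exists_table_apply_eq hT hab h
  have hswap := congrArg M (add_right_comm n (Pi.single b 1) (Pi.single a 1))
  simp only [hg, sum_add_single_one] at hswap
  simp only [Pi.add_apply, Pi.single_eq_of_ne hab,
    Pi.single_eq_of_ne hab.symm, add_zero] at hswap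
  refine mul_left_cancel₀ (hM.pos n).ne' ?_
  linear_combination hswap

lemma exists_predictive_eq_add (N : ℕ) : ∃ c, ∀ a, ∀ x ≤ N, g a x N = g a 0 N + c * x := by
  cases N with
  | zero => exact ⟨0, by simp⟩
  | succ N =>
    obtain ⟨c, hc⟩ := exists_forall_eq_of_apply_eq_of_add_le hT
      (fun a b hab x y => predictive_sub_eq hT hM hg hab (N := N))
    refine ⟨c, fun a x hx => ?_⟩
    induction x with
    | zero => simp
    | succ x ih =>
      push_cast
      linear_combination ih (by lia) + hc a x (by lia)

lemma exists_predictive_succ_eq_mul (N : ℕ) :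
    ∃ ρ > 0, ∀ a, ∀ x ≤ N, g a x (N + 1) = ρ * g a x N := by
  obtain ⟨ρ, hρ⟩ := exists_forall_eq_of_apply_eq_of_add_le hT
    (fun a b hab x y => predictive_div_eq hT hM hg hab (N := N))
  have hpos (a : T) {x : ℕ} (hx : x ≤ N) : 0 < g a x N := predictive_pos hT hM hg a hx
  refine ⟨ρ, ?_, fun a x hx => (div_eq_iff (hpos a hx).ne').1 (hρ a x hx)⟩
  obtain ⟨t⟩ : Nonempty T := (ENat.card_pos_iff_nonempty T).1 (hT.trans_lt' (by norm_num))
  rw [← hρ t 0 N.zero_le]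
  exact div_pos (predictive_pos hT hM hg t (by lia)) (hpos t N.zero_le)

lemma exists_predictive_eq_mul_add :
    ∃ κ, ∀ N, ∃ d > 0, ∀ a, ∀ x ≤ N, g a x N = d * (g a 0 0 + κ * x) := by
  obtain ⟨t⟩ : Nonempty T := (ENat.card_pos_iff_nonempty T).1 (hT.trans_lt' (by norm_num))
  choose c hc using exists_predictive_eq_add hT hM hg
  choose ρ hρ0 hρ using exists_predictive_succ_eq_mul hT hM hg
  refine ⟨c 1 / ρ 0, fun N => ?_⟩
  induction N with
  | zero => exact ⟨1, one_pos, by simp⟩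
  | succ N ih =>
    obtain ⟨d, hd0, hd⟩ := ih
    refine ⟨ρ N * d, mul_pos (hρ0 N) hd0, fun a x hx => ?_⟩
    have hslope : c (N + 1) = ρ N * d * (c 1 / ρ 0) := by
      rcases N.eq_zero_or_pos with rfl | hN
      · have hd1 : d = 1 := by
          have := hd t 0 le_rfl
          have hpos := predictive_pos hT hM hg t (le_refl 0)
          simp only [Nat.cast_zero, mul_zero, add_zero] at this
          exact (mul_eq_right₀ hpos.ne').1 this.symm
        rw [hd1, mul_one, mul_div_cancel₀ _ (hρ0 0).ne']
      · have h₁ := hc (N + 1) t 1 (by lia)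
        rw [hρ N t 1 hN, hρ N t 0 N.zero_le, hd t 1 hN, hd t 0 N.zero_le] at h₁
        push_cast at h₁
        linear_combination -h₁
    rw [hc (N + 1) a x hx, hρ N a 0 N.zero_le, hd a 0 N.zero_le, hslope]
    push_cast
    ring

end Predictive

theorem JohnsonSufficient.exists_polyaRecursion (hT : 3 ≤ ENat.card T)
    (hM : IsSimplexMoments M) (h : JohnsonSufficient M) :
    ∃ κ, 0 ≤ κ ∧ PolyaRecursion κ (fun t => M (Pi.single t 1)) M := by
  obtain ⟨g, hg⟩ := h
  obtain ⟨κ, hκ⟩ := exists_predictive_eq_mul_add hT hM hg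
  have hbase (t : T) : M (Pi.single t 1) = g t 0 0 := by
    have := hg 0 t
    simpa [hM.zero] using this
  refine ⟨κ, ?_, fun n t => ?_⟩
  · obtain ⟨t⟩ : Nonempty T := (ENat.card_pos_iff_nonempty T).1 (hT.trans_lt' (by norm_num))
    by_contra! hneg
    obtain ⟨N, hN⟩ := exists_nat_ge (g t 0 0 / -κ)
    obtain ⟨d, hd0, hd⟩ := hκ N
    have hpos := predictive_pos hT hM hg t (le_refl N)
    rw [hd t N le_rfl, mul_pos_iff_of_pos_left hd0] at hpos
    rw [div_le_iff₀ (neg_pos.2 hneg)] at hN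
    linarith
  · have hle (s : T) : n s ≤ ∑ s, n s := Finset.single_le_sum_of_canonicallyOrdered (by simp)
    obtain ⟨d, -, hd⟩ := hκ (∑ s, n s)
    have hsum := sum_predictive hM hg n
    simp only [hd _ _ (hle _), ← Finset.mul_sum] at hsum
    simp only [hbase]
    rw [hg, hd _ _ (hle t)]
    linear_combination M n * (g t 0 0 + κ * n t) * hsum

end Johnson

section RowFactorization

lemma exists_eq_of_apply_add_single_eq {T β : Type*} [Fintype T] [DecidableEq T]
    {Q : (T → ℕ) → β} {t₀ t₁ : T} (h₁ : t₁ ≠ t₀)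
    (hQ : ∀ n : T → ℕ, ∀ t ≠ t₀, Q (n + Pi.single t 1) = Q (n + Pi.single t₁ 1)) :
    ∃ q : ℕ → ℕ → β, ∀ n, Q n = q (n t₀) (∑ t, n t) := by
  suffices hgather : ∀ n m, Q (m + n) =
      Q (m + Pi.single t₀ (n t₀) + Pi.single t₁ (∑ t ∈ Finset.univ.erase t₀, n t)) by
    refine ⟨fun x N => Q (Pi.single t₀ x + Pi.single t₁ (N - x)), fun n => ?_⟩
    have hrest : ∑ t, n t - n t₀ = ∑ t ∈ Finset.univ.erase t₀, n t := by
      rw [← Finset.add_sum_erase _ n (Finset.mem_univ t₀), Nat.add_sub_cancel_left]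
    simpa only [zero_add, hrest] using hgather n 0
  intro n
  induction n using table_induction with
  | zero => simp
  | add_single n t ih =>
    intro m
    by_cases ht : t = t₀
    · subst ht
      have hshift := ih (m + Pi.single t 1)
      simp only [add_assoc, Pi.add_apply, Finset.sum_add_distrib, Finset.sum_pi_single',
        Pi.single_eq_same, Finset.notMem_erase, if_false, add_zero, Pi.single_add] at hshift ⊢
      rw [add_comm n, hshift, add_left_comm (Pi.single t 1)]
    · have hshift := ih (m + Pi.single t₁ 1)
      simp only [Pi.add_apply, Finset.sum_add_distrib, Finset.sum_pi_single', Pi.single_add,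
        Pi.single_eq_of_ne (Ne.symm ht), Finset.mem_erase_of_ne_of_mem ht (Finset.mem_univ t),
        if_true, add_zero]
      rw [← add_assoc, hQ _ t ht, add_right_comm, hshift]
      congr 1
      abel

variable {I J : Type*} [Fintype I] [Fintype J] [DecidableEq I] [DecidableEq J]
  {M : (I × J → ℕ) → ℝ} {A : (I → ℕ) → ℝ} {B : I → (J → ℕ) → ℝ}

omit [Fintype I] in
lemma sum_row_add_single (r : I × J → ℕ) (i : I) (j : J) :
    (fun i' => ∑ j', (r + Pi.single (i, j) 1 : I × J → ℕ) (i', j')) =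
      (fun i' => ∑ j', r (i', j')) + Pi.single i 1 := by
  funext i'
  simp only [Pi.add_apply, Finset.sum_add_distrib, Pi.single_apply, Prod.mk.injEq]
  by_cases h : i' = i <;> simp [h]

omit [Fintype I] [Fintype J] in
lemma row_add_single_self (r : I × J → ℕ) (i : I) (j : J) :
    (fun j' => (r + Pi.single (i, j) 1 : I × J → ℕ) (i, j')) =
      (fun j' => r (i, j')) + Pi.single j 1 := by
  funext j'
  simp [Pi.single_apply]

omit [Fintype I] [Fintype J] in
lemma row_add_single_of_ne (r : I × J → ℕ) {i i' : I} (h : i' ≠ i) (j : J) :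
    (fun j' => (r + Pi.single (i, j) 1 : I × J → ℕ) (i', j')) = fun j' => r (i', j') := by
  funext j'
  simp [h]

/-- The moments of a random two-way table whose vector of row totals and whose normalized rows are
independent: `A` are the moments of the row totals and `B i` those of the normalized row `i`. -/
structure IsRowFactorization (M : (I × J → ℕ) → ℝ) (A : (I → ℕ) → ℝ)
    (B : I → (J → ℕ) → ℝ) : Prop where
  left : IsSimplexMoments A
  row : ∀ i, IsSimplexMoments (B i)
  eq_mul_prod : ∀ r, M r = A (fun i => ∑ j, r (i, j)) * ∏ i, B i fun j => r (i, j)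

namespace IsRowFactorization

variable (h : IsRowFactorization M A B)

include h

lemma eq_mul_mul_prod_erase (r : I × J → ℕ) (i : I) : M r = A (fun i => ∑ j, r (i, j)) *
    (B i (fun j => r (i, j)) * ∏ i' ∈ Finset.univ.erase i, B i' fun j => r (i', j)) := by
  rw [h.eq_mul_prod, Finset.mul_prod_erase _ (fun i => B i fun j => r (i, j)) (Finset.mem_univ i)]

lemma apply_add_single (r : I × J → ℕ) (i : I) (j : J) :
    M (r + Pi.single (i, j) 1) = A ((fun i => ∑ j, r (i, j)) + Pi.single i 1) *
      (B i ((fun j => r (i, j)) + Pi.single j 1) *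
        ∏ i' ∈ Finset.univ.erase i, B i' fun j => r (i', j)) := by
  rw [h.eq_mul_mul_prod_erase _ i, sum_row_add_single, row_add_single_self]
  congr 2
  exact Finset.prod_congr rfl fun i' hi' => by
    rw [row_add_single_of_ne r (Finset.ne_of_mem_erase hi')]

lemma prod_erase_pos (r : I × J → ℕ) (i : I) :
    0 < ∏ i' ∈ Finset.univ.erase i, B i' fun j => r (i', j) :=
  Finset.prod_pos fun i' _ => (h.row i').pos _

lemma sum_apply_add_single (r : I × J → ℕ) (i : I) :
    ∑ j, M (r + Pi.single (i, j) 1) = A ((fun i => ∑ j, r (i, j)) + Pi.single i 1) *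
      ∏ i, B i fun j => r (i, j) := by
  simp only [h.apply_add_single, ← Finset.mul_sum, ← Finset.sum_mul, (h.row i).sum_add_single]
  rw [Finset.mul_prod_erase _ (fun i => B i fun j => r (i, j)) (Finset.mem_univ i)]

lemma isSimplexMoments : IsSimplexMoments M where
  zero := by
    have hleft := h.left.zero
    have hrow (i : I) := (h.row i).zero
    simp only [Pi.zero_def] at hleft hrow
    simp [h.eq_mul_prod, hleft, hrow]
  pos r := by
    rw [h.eq_mul_prod]
    exact mul_pos (h.left.pos _) (Finset.prod_pos fun i _ => (h.row i).pos _)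
  sum_add_single r := by
    simp only [Fintype.sum_prod_type, h.sum_apply_add_single, ← Finset.sum_mul,
      h.left.sum_add_single]
    exact (h.eq_mul_prod r).symm

lemma apply_add_single_div_eq (r : I × J → ℕ) {i i' : I} (hi : i' ≠ i) (j j₁ j₂ : J) :
    M (r + Pi.single (i', j₁) 1 + Pi.single (i, j) 1) / M (r + Pi.single (i', j₁) 1) =
      M (r + Pi.single (i', j₂) 1 + Pi.single (i, j) 1) / M (r + Pi.single (i', j₂) 1) := by
  have hratio (k : J) :
      M (r + Pi.single (i', k) 1 + Pi.single (i, j) 1) / M (r + Pi.single (i', k) 1) =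
        A ((fun i => ∑ j, r (i, j)) + Pi.single i' 1 + Pi.single i 1) /
          A ((fun i => ∑ j, r (i, j)) + Pi.single i' 1) *
        (B i ((fun j => r (i, j)) + Pi.single j 1) / B i (fun j => r (i, j))) := by
    rw [h.apply_add_single, h.eq_mul_mul_prod_erase (r + Pi.single (i', k) 1) i,
      sum_row_add_single, row_add_single_of_ne r hi.symm, ← mul_assoc, ← mul_assoc,
      mul_div_mul_right _ _ (h.prod_erase_pos _ i).ne', mul_div_mul_comm]
  rw [hratio, hratio]

lemma polyaRecursion_left [Nonempty J] {κ : ℝ} {a : I × J → ℝ} (hM : PolyaRecursion κ a M) :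
    PolyaRecursion κ (fun i => ∑ j, a (i, j)) A := by
  intro n i
  obtain ⟨j₀⟩ := ‹Nonempty J›
  set r : I × J → ℕ := fun x => (Pi.single j₀ (n x.1) : J → ℕ) x.2
  have hn : (fun i => ∑ j, r (i, j)) = n := by funext i; simp [r]
  have hn' (i : I) : ∑ j, (a (i, j) + κ * r (i, j)) = ∑ j, a (i, j) + κ * n i := by
    rw [Finset.sum_add_distrib, ← Finset.mul_sum, ← Nat.cast_sum, congrFun hn i]
  have hsum := Finset.sum_congr rfl fun j (_ : j ∈ Finset.univ) => hM r (i, j)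
  rw [← Finset.sum_mul, ← Finset.mul_sum, h.sum_apply_add_single, h.eq_mul_prod,
    Fintype.sum_prod_type] at hsum
  simp only [hn, hn'] at hsum
  have hpos : 0 < ∏ i, B i fun j => r (i, j) := Finset.prod_pos fun i _ => (h.row i).pos _
  refine mul_right_cancel₀ hpos.ne' ?_
  linear_combination hsum

lemma polyaRecursion_row [Nonempty J] {κ : ℝ} {a : I × J → ℝ} (hM : PolyaRecursion κ a M)
    (i : I) : PolyaRecursion κ (fun j => a (i, j)) (B i) := by
  intro m j
  set r : I × J → ℕ := fun x => m x.2
  have hleft := h.polyaRecursion_left hM (fun i => ∑ j, r (i, j)) i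
  have hcell := hM r (i, j)
  rw [h.apply_add_single, h.eq_mul_mul_prod_erase r i, Fintype.sum_prod_type] at hcell
  simp only [Finset.sum_add_distrib, ← Finset.mul_sum, Nat.cast_sum] at hleft hcell ⊢
  refine mul_right_cancel₀ (mul_pos (h.left.pos fun i => ∑ j, r (i, j))
    (h.prod_erase_pos r i)).ne' ?_
  linear_combination hcell - B i (m + Pi.single j 1) * (∏ i' ∈ Finset.univ.erase i, B i' m) * hleft

end IsRowFactorization

omit [Fintype I] [Fintype J] in
lemma add_single_comp_swap (r : I × J → ℕ) (i : I) (j : J) :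
    (r + Pi.single (i, j) 1) ∘ Prod.swap = r ∘ Prod.swap + Pi.single (j, i) 1 := by
  funext ⟨j', i'⟩
  simp [Pi.single_apply, and_comm]

/-- The ratio `M (r + e_t) / M r` does not change when a count outside the cell `t` is moved to a
cell in another row and another column: one move is made within a row, the other within a column. -/
theorem IsRowFactorization.johnsonSufficient [Nontrivial I] [Nontrivial J] {A' : (J → ℕ) → ℝ}
    {B' : J → (I → ℕ) → ℝ} (h : IsRowFactorization M A B)
    (h' : IsRowFactorization (fun r => M (r ∘ Prod.swap)) A' B') : JohnsonSufficient M := by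
  have hcol (r : I × J → ℕ) {j j' : J} (hj : j' ≠ j) (i i₁ i₂ : I) :
      M (r + Pi.single (i₁, j') 1 + Pi.single (i, j) 1) / M (r + Pi.single (i₁, j') 1) =
        M (r + Pi.single (i₂, j') 1 + Pi.single (i, j) 1) / M (r + Pi.single (i₂, j') 1) := by
    simpa only [← add_single_comp_swap, Function.comp_assoc, Prod.swap_swap_eq, Function.comp_id]
      using h'.apply_add_single_div_eq (r ∘ Prod.swap) hj i i₁ i₂
  have hratio (t : I × J) : ∃ q : ℕ → ℕ → ℝ, ∀ r,
      M (r + Pi.single t 1) / M r = q (r t) (∑ s, r s) := by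
    obtain ⟨i, j⟩ := t
    obtain ⟨i₁, hi⟩ := exists_ne i
    obtain ⟨j₁, hj⟩ := exists_ne j
    refine exists_eq_of_apply_add_single_eq (t₁ := (i₁, j₁)) (by simp [hi]) fun r ⟨i', j'⟩ hne => ?_
    by_cases hi' : i' = i
    · have hj' : j' ≠ j := fun hj' => hne (Prod.ext hi' hj')
      exact (hcol r hj' i i' i₁).trans (h.apply_add_single_div_eq r hi j j' j₁)
    · exact (h.apply_add_single_div_eq r hi' j j' j₁).trans (hcol r hj i i' i₁)
  choose g hg using hratio
  exact ⟨g, fun r t => by rw [← hg, mul_div_cancel₀ _ (h.isSimplexMoments.pos r).ne']⟩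

end RowFactorization

section Tree

variable {V : Type*} [Fintype V] {G : SimpleGraph V} [DecidableRel G.Adj]

lemma mem_rootedParents {r u w : V} :
    u ∈ rootedParents G r w ↔ G.Adj u w ∧ G.dist r w = G.dist r u + 1 := by
  simp [rootedParents]

lemma rootedParents_self (r : V) : rootedParents G r r = ∅ := by
  ext u
  simp [mem_rootedParents]

lemma notMem_rootedParents_self (r w : V) : w ∉ rootedParents G r w := by
  simp [mem_rootedParents]

lemma ne_root_of_mem_rootedParents {r u w : V} (hu : u ∈ rootedParents G r w) : w ≠ r := by
  rintro rfl
  simp [rootedParents_self] at hu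

lemma eq_of_mem_rootedParents (hG : G.IsTree) {r u u' w : V} (hu : u ∈ rootedParents G r w)
    (hu' : u' ∈ rootedParents G r w) : u = u' := by
  rw [mem_rootedParents] at hu hu'
  obtain ⟨p, hp⟩ := hG.connected.exists_walk_length_eq_dist r u
  obtain ⟨p', hp'⟩ := hG.connected.exists_walk_length_eq_dist r u'
  have hpath : (p.concat hu.1).IsPath :=
    SimpleGraph.Walk.isPath_of_length_eq_dist _ (by simp [hp, hu.2])
  have hpath' : (p'.concat hu'.1).IsPath :=
    SimpleGraph.Walk.isPath_of_length_eq_dist _ (by simp [hp', hu'.2])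
  simpa using congrArg SimpleGraph.Walk.penultimate
    ((hG.existsUnique_path r w).unique hpath hpath')

lemma rootedParents_eq_singleton (hG : G.IsTree) {r u w : V} (hu : u ∈ rootedParents G r w) :
    rootedParents G r w = {u} :=
  Finset.eq_singleton_iff_unique_mem.2 ⟨hu, fun _ h => eq_of_mem_rootedParents hG h hu⟩

lemma card_rootedParents_le_one (hG : G.IsTree) (r w : V) : (rootedParents G r w).card ≤ 1 :=
  Finset.card_le_one.2 fun _ hu _ hu' => eq_of_mem_rootedParents hG hu hu'

lemma exists_rootedParents_eq_singleton (hG : G.IsTree) {r w : V} (hw : w ≠ r) :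
    ∃ u, rootedParents G r w = {u} := by
  obtain ⟨p, hp⟩ := hG.connected.exists_walk_length_eq_dist r w
  have hnil : ¬ p.Nil := fun h => hw h.eq.symm
  have hadj := p.adj_penultimate hnil
  have hlast : G.dist r p.penultimate ≤ p.length - 1 := by
    simpa using SimpleGraph.dist_le p.dropLast
  have hlength : p.length ≠ 0 := fun h => hnil (SimpleGraph.Walk.length_eq_zero_iff.1 h)
  have hdist := hG.dist_eq_dist_add_one_of_adj r hadj
  exact ⟨p.penultimate,
    rootedParents_eq_singleton hG (mem_rootedParents.2 ⟨hadj, by lia⟩)⟩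

lemma mem_rootedParents_or (hG : G.IsTree) (r : V) {u w : V} (h : G.Adj u w) :
    u ∈ rootedParents G r w ∨ w ∈ rootedParents G r u := by
  rcases hG.dist_eq_dist_add_one_of_adj r h with h' | h'
  · exact Or.inr (mem_rootedParents.2 ⟨h.symm, h'⟩)
  · exact Or.inl (mem_rootedParents.2 ⟨h, h'⟩)

/-- The root is a vertex behind `u`, seen from `w`, at maximal distance from `w`. -/
lemma exists_leaf_rootedParents_eq (hG : G.IsTree) {u w : V} (h : G.Adj u w) :
    ∃ r, G.degree r = 1 ∧ rootedParents G r w = {u} := by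
  classical
  obtain ⟨r, hr, hmax⟩ := Finset.exists_max_image
    (Finset.univ.filter fun x => G.dist x w = G.dist x u + 1) (fun x => G.dist x w)
    ⟨u, by simp [h]⟩
  simp only [Finset.mem_filter, Finset.mem_univ, true_and] at hr hmax
  refine ⟨r, ?_, rootedParents_eq_singleton hG (mem_rootedParents.2 ⟨h, hr⟩)⟩
  have hrw : r ≠ w := by
    rintro rfl
    simp at hr
  obtain ⟨y, hy⟩ := exists_rootedParents_eq_singleton hG hrw
  have hyr := mem_rootedParents.1 (hy ▸ Finset.mem_singleton_self y)
  rw [SimpleGraph.degree, Finset.card_eq_one]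
  refine ⟨y, Finset.eq_singleton_iff_unique_mem.2 ⟨by simpa using hyr.1.symm, fun z hz => ?_⟩⟩
  rw [SimpleGraph.mem_neighborFinset] at hz
  rcases mem_rootedParents_or hG w hz with hfar | hnear
  · rw [mem_rootedParents, SimpleGraph.dist_comm, SimpleGraph.dist_comm (u := w)] at hfar
    have hzw := hG.connected.dist_triangle (u := z) (v := u) (w := w)
    have hzu := hG.connected.dist_triangle (u := z) (v := r) (w := u)
    rw [SimpleGraph.dist_eq_one_iff_adj.2 h] at hzw
    rw [SimpleGraph.dist_eq_one_iff_adj.2 hz.symm] at hzu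
    have := hmax z (by lia)
    lia
  · simpa [hy] using hnear

variable [DecidableEq V]

lemma injOn_insert_rootedParents (r : V) :
    Set.InjOn (fun w => insert w (rootedParents G r w)) (Finset.univ.erase r : Finset V) := by
  intro a _ b _ hab
  by_contra hne
  simp only at hab
  have ha : a ∈ insert b (rootedParents G r b) := hab ▸ Finset.mem_insert_self a _
  have hb : b ∈ insert a (rootedParents G r a) := hab ▸ Finset.mem_insert_self b _
  simp only [Finset.mem_insert, hne, Ne.symm hne, false_or, mem_rootedParents] at ha hb
  lia

lemma card_filter_mem_insert_rootedParents (r u : V) :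
    ((Finset.univ.erase r).filter fun w => u ∈ insert w (rootedParents G r w)).card +
        (if u = r then 1 else 0) =
      (Finset.univ.filter fun w => u ∈ rootedParents G r w).card + 1 := by
  have hunion : ((Finset.univ.erase r).filter fun w => u ∈ insert w (rootedParents G r w)) =
      (Finset.univ.filter fun w => u ∈ rootedParents G r w) ∪ Finset.erase {u} r := by
    ext w
    have := ne_root_of_mem_rootedParents (G := G) (r := r) (u := u) (w := w)
    simp only [Finset.mem_filter, Finset.mem_erase, Finset.mem_univ, Finset.mem_insert,
      Finset.mem_union, Finset.mem_singleton]
    tauto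
  have hdisj : Disjoint (Finset.univ.filter fun w => u ∈ rootedParents G r w)
      (Finset.erase {u} r) := by
    simp only [Finset.disjoint_left, Finset.mem_filter, Finset.mem_erase, Finset.mem_singleton]
    rintro w ⟨-, hw⟩ ⟨-, rfl⟩
    exact notMem_rootedParents_self r w hw
  rw [hunion, Finset.card_union_of_disjoint hdisj, add_assoc]
  by_cases hu : u = r
  · simp [hu]
  · simp [hu, Ne.symm hu]

omit [Fintype V] [DecidableRel G.Adj] in
lemma maximal_isClique_pair (hG : G.IsTree) {u w : V} (h : G.Adj u w) :
    Maximal (fun s : Finset V => G.IsClique (s : Set V)) {u, w} := by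
  refine ⟨by simpa using fun _ => h, fun t ht hle x hx => ?_⟩
  by_contra hne
  simp only [Finset.mem_insert, Finset.mem_singleton, not_or] at hne
  have hu : G.Adj x u := ht hx (hle (by simp)) hne.1
  have hw : G.Adj x w := ht hx (hle (by simp)) hne.2
  exact hG.dist_ne_of_adj x h
    ((SimpleGraph.dist_eq_one_iff_adj.2 hu).trans (SimpleGraph.dist_eq_one_iff_adj.2 hw).symm)

variable [Nontrivial V]

omit [Fintype V] [DecidableRel G.Adj] in
lemma maximal_isClique_iff (hG : G.IsTree) {D : Finset V} :
    Maximal (fun s : Finset V => G.IsClique (s : Set V)) D ↔ ∃ u w, G.Adj u w ∧ D = {u, w} := by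
  constructor
  · intro hD
    obtain ⟨u, w, huw, hle | hle⟩ : ∃ u w, G.Adj u w ∧ (D ⊆ {u, w} ∨ {u, w} ⊆ D) := by
      rcases (D : Set V).subsingleton_or_nontrivial with hsub | ⟨a, ha, b, hb, hab⟩
      · obtain ⟨v, hv⟩ : ∃ v, ∀ x ∈ D, x = v := by
          rcases D.eq_empty_or_nonempty with rfl | ⟨v, hv⟩
          · exact ⟨hG.connected.nonempty.some, by simp⟩
          · exact ⟨v, fun x hx => hsub hx hv⟩
        obtain ⟨w, hw⟩ := hG.connected.preconnected.exists_adj_of_nontrivial v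
        exact ⟨v, w, hw, Or.inl fun x hx => by simp [hv x hx]⟩
      · exact ⟨a, b, hD.1 ha hb hab, Or.inr (Finset.insert_subset ha (by simpa using hb))⟩
    · exact ⟨u, w, huw, hD.eq_of_le (maximal_isClique_pair hG huw).1 hle⟩
    · exact ⟨u, w, huw, ((maximal_isClique_pair hG huw).eq_of_le hD.1 hle).symm⟩
  · rintro ⟨u, w, h, rfl⟩
    exact maximal_isClique_pair hG h

namespace IsPerfectOrder

variable {K : ℕ} {C : Fin K → Finset V} (hC : IsPerfectOrder G C) (hG : G.IsTree)

include hC hG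

lemma image_eq (r : V) : Finset.univ.image C =
    (Finset.univ.erase r).image fun w => insert w (rootedParents G r w) := by
  ext D
  have hrange : D ∈ Finset.univ.image C ↔ D ∈ Set.range C := by simp
  rw [hrange, hC.mem_range_iff, maximal_isClique_iff hG]
  simp only [Finset.mem_image, Finset.mem_erase, Finset.mem_univ, and_true]
  constructor
  · rintro ⟨u, w, h, rfl⟩
    rcases mem_rootedParents_or hG r h with h | h
    · exact ⟨w, ne_root_of_mem_rootedParents h,
        by rw [rootedParents_eq_singleton hG h, Finset.pair_comm]⟩
    · exact ⟨u, ne_root_of_mem_rootedParents h, by rw [rootedParents_eq_singleton hG h]⟩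
  · rintro ⟨w, hw, rfl⟩
    obtain ⟨u, hu⟩ := exists_rootedParents_eq_singleton hG hw
    have h := (mem_rootedParents.1 (hu ▸ Finset.mem_singleton_self u : u ∈ rootedParents G r w)).1
    exact ⟨w, u, h.symm, by rw [hu]⟩

lemma prod_eq {M : Type*} [CommMonoid M] (r : V) (F : Finset V → M) :
    ∏ l, F (C l) = ∏ w ∈ Finset.univ.erase r, F (insert w (rootedParents G r w)) := by
  rw [← Finset.prod_image (f := F) (fun a _ b _ h => hC.injective h), hC.image_eq hG r,
    Finset.prod_image (injOn_insert_rootedParents r)]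

omit [DecidableRel G.Adj] in
lemma card_add_one : K + 1 = Fintype.card V := by
  classical
  obtain ⟨r⟩ := hG.connected.nonempty
  have h := congrArg Finset.card (hC.image_eq hG r)
  rw [Finset.card_image_of_injective _ hC.injective, Finset.card_image_of_injOn
    (injOn_insert_rootedParents r), Finset.card_univ, Fintype.card_fin] at h
  rw [h, Finset.card_erase_add_one (Finset.mem_univ r), Finset.card_univ]

omit [Fintype V] [DecidableRel G.Adj] in
lemma card_eq_two (l : Fin K) : (C l).card = 2 := by
  obtain ⟨u, w, h, hl⟩ := (maximal_isClique_iff hG).1 ((hC.mem_range_iff _).1 ⟨l, rfl⟩)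
  rw [hl, Finset.card_pair h.ne]

omit [Fintype V] [DecidableRel G.Adj] in
lemma card_separator_le_one (l : Fin K) : (separator C l).card ≤ 1 := by
  rcases Nat.eq_zero_or_pos (l : ℕ) with h | h
  · have hfirst : Finset.Iio l = ∅ := by
      ext x
      simp [Fin.lt_def, h]
    simp [separator, hfirst]
  · obtain ⟨i, hi, hsub⟩ := hC.perfect l h
    by_contra! hlt
    have heq {m : Fin K} (hm : separator C l ⊆ C m) : separator C l = C m :=
      Finset.eq_of_subset_of_card_le hm (by rw [hC.card_eq_two hG]; lia)
    exact hi.ne (hC.injective ((heq hsub).symm.trans (heq Finset.inter_subset_left)))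

omit [Fintype V] [DecidableRel G.Adj] in
/-- A vertex lies in the separators of all cliques that contain it, except for the first one. -/
lemma card_filter_mem_separator_add_one (u : V) :
    (Finset.univ.filter fun l => u ∈ separator C l).card + 1 =
      (Finset.univ.filter fun l => u ∈ C l).card := by
  have hne : (Finset.univ.filter fun l => u ∈ C l).Nonempty := by
    obtain ⟨w, hw⟩ := hG.connected.preconnected.exists_adj_of_nontrivial u
    obtain ⟨l, hl⟩ := (hC.mem_range_iff _).2 (maximal_isClique_pair hG hw)
    exact ⟨l, by simp [hl]⟩
  obtain ⟨l₀, hl₀, hmin⟩ := Finset.exists_min_image _ id hne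
  have herase : (Finset.univ.filter fun l => u ∈ separator C l) =
      (Finset.univ.filter fun l => u ∈ C l).erase l₀ := by
    ext l
    simp only [Finset.mem_filter, Finset.mem_univ, true_and, Finset.mem_erase, separator,
      Finset.mem_inter, Finset.mem_biUnion, Finset.mem_Iio, id] at hmin hl₀ ⊢
    constructor
    · rintro ⟨hl, i, hi, hui⟩
      exact ⟨((hmin i hui).trans_lt hi).ne', hl⟩
    · rintro ⟨hne, hl⟩
      exact ⟨hl, l₀, lt_of_le_of_ne (hmin l hl) (Ne.symm hne), hl₀⟩
  rw [herase, Finset.card_erase_add_one hl₀]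

lemma card_filter_mem_rootedParents (r u : V) :
    (Finset.univ.filter fun w => u ∈ rootedParents G r w).card =
      (Finset.univ.filter fun l => u ∈ separator C l).card + if u = r then 1 else 0 := by
  have hcard := congrArg (fun s => (s.filter (u ∈ ·)).card) (hC.image_eq hG r)
  simp only [Finset.filter_image] at hcard
  rw [Finset.card_image_of_injective _ hC.injective, Finset.card_image_of_injOn
    ((injOn_insert_rootedParents r).mono (Finset.filter_subset _ _))] at hcard
  have hclique := hC.card_filter_mem_separator_add_one hG u
  have hparent := card_filter_mem_insert_rootedParents (G := G) r u
  lia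

end IsPerfectOrder

omit [Fintype V] [Nontrivial V]

omit [DecidableEq V] in
lemma eq_mul_prod_of_card_le_one {F : Finset V → ℝ} (hF : F ∅ ≠ 0) {S : Finset V}
    (hS : S.card ≤ 1) : F S = F ∅ * ∏ u ∈ S, F {u} / F ∅ := by
  rcases S.eq_empty_or_nonempty with rfl | hne
  · simp
  · obtain ⟨v, rfl⟩ := Finset.card_eq_one.1 (le_antisymm hS (Finset.card_pos.2 hne))
    rw [Finset.prod_singleton, mul_div_cancel₀ _ hF]

variable [Fintype V]

lemma prod_eq_pow_mul_prod {ι : Type*} [Fintype ι] {F : Finset V → ℝ} (hF : F ∅ ≠ 0)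
    {S : ι → Finset V} (hS : ∀ i, (S i).card ≤ 1) :
    ∏ i, F (S i) =
      F ∅ ^ Fintype.card ι * ∏ u, (F {u} / F ∅) ^ (Finset.univ.filter fun i => u ∈ S i).card := by
  rw [Finset.prod_congr rfl fun i _ => eq_mul_prod_of_card_le_one hF (hS i),
    Finset.prod_mul_distrib, Finset.prod_const, Finset.card_univ,
    Finset.prod_comm' (t' := Finset.univ) (s' := fun u => Finset.univ.filter fun i => u ∈ S i)
      (by simp)]
  simp only [Finset.prod_const]

variable [Nontrivial V]

theorem IsPerfectOrder.prod_div_prod_separator {K : ℕ} {C : Fin K → Finset V}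
    (hC : IsPerfectOrder G C) (hG : G.IsTree) (r : V) {F : Finset V → ℝ} (hF : ∀ D, F D ≠ 0) :
    (∏ l, F (C l)) / ∏ l, F (separator C l) =
      ∏ w, F (insert w (rootedParents G r w)) / F (rootedParents G r w) := by
  have hroot : ∏ u, (F {u} / F ∅) ^ (if u = r then 1 else 0) = F {r} / F ∅ := by
    rw [Fintype.prod_eq_single r fun u hu => by simp [hu]]
    simp
  have hparents : ∏ w, F (rootedParents G r w) = F {r} * ∏ l, F (separator C l) := by
    rw [prod_eq_pow_mul_prod (hF ∅) (card_rootedParents_le_one hG r),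
      prod_eq_pow_mul_prod (hF ∅) (hC.card_separator_le_one hG), Fintype.card_fin,
      ← hC.card_add_one hG]
    simp only [hC.card_filter_mem_rootedParents hG, pow_add, Finset.prod_mul_distrib, hroot]
    have := hF ∅
    field_simp
  have hfamilies : ∏ w, F (insert w (rootedParents G r w)) = F {r} * ∏ l, F (C l) := by
    rw [hC.prod_eq hG r, ← Finset.mul_prod_erase _ _ (Finset.mem_univ r), rootedParents_self,
      insert_empty_eq]
  rw [Finset.prod_div_distrib, hparents, hfamilies, mul_div_mul_left _ _ (hF _)]

end Tree

section RandomSimplex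

variable {Ω : Type*} [MeasurableSpace Ω] {μ : Measure Ω} {T : Type*} [Fintype T]

/-- The moments `𝔼 ∏ t, X t ^ n t` of a random vector `X`. -/
noncomputable def moment (μ : Measure Ω) (X : Ω → T → ℝ) (n : T → ℕ) : ℝ :=
  ∫ ω, ∏ t, X ω t ^ n t ∂μ

/-- A random vector with values in the open standard simplex. -/
structure IsRandomSimplex (μ : Measure Ω) (X : Ω → T → ℝ) : Prop where
  measurable : Measurable X
  pos : ∀ᵐ ω ∂μ, ∀ t, 0 < X ω t
  sum_eq_one : ∀ᵐ ω ∂μ, ∑ t, X ω t = 1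

lemma prod_pow_add_single [DecidableEq T] (x : T → ℝ) (n : T → ℕ) (t : T) :
    ∏ s, x s ^ (n + Pi.single t 1 : T → ℕ) s = (∏ s, x s ^ n s) * x t := by
  simp only [Pi.add_apply, pow_add, Finset.prod_mul_distrib]
  rw [Fintype.prod_eq_single (f := fun s => x s ^ (Pi.single t 1 : T → ℕ) s) t
    fun s hs => by simp [hs]]
  simp

lemma moment_single [DecidableEq T] (X : Ω → T → ℝ) (t : T) :
    moment μ X (Pi.single t 1) = ∫ ω, X ω t ∂μ := by
  simpa [moment] using congrArg (∫ ω, · ω ∂μ) (funext fun ω => prod_pow_add_single (X ω) 0 t)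

namespace IsRandomSimplex

variable {X : Ω → T → ℝ} (hX : IsRandomSimplex μ X)

include hX

lemma measurable_apply (t : T) : Measurable fun ω => X ω t :=
  measurable_pi_iff.1 hX.measurable t

lemma ae_apply_mem_Icc (t : T) : ∀ᵐ ω ∂μ, X ω t ∈ Set.Icc (0 : ℝ) 1 := by
  filter_upwards [hX.pos, hX.sum_eq_one] with ω hpos hsum
  exact ⟨(hpos t).le,
    hsum ▸ Finset.single_le_sum (fun s _ => (hpos s).le) (Finset.mem_univ t)⟩

variable [IsProbabilityMeasure μ]

lemma nonempty : Nonempty T := by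
  by_contra hT
  rw [not_nonempty_iff] at hT
  obtain ⟨ω, hω⟩ := hX.sum_eq_one.exists
  simp at hω

lemma integrable_apply (t : T) : Integrable (fun ω => X ω t) μ :=
  Integrable.of_mem_Icc 0 1 (hX.measurable_apply t).aemeasurable (hX.ae_apply_mem_Icc t)

lemma integrable_prod_pow (n : T → ℕ) : Integrable (fun ω => ∏ t, X ω t ^ n t) μ := by
  refine Integrable.of_mem_Icc 0 1 (Finset.measurable_fun_prod _ fun t _ =>
    (hX.measurable_apply t).pow_const _).aemeasurable ?_
  filter_upwards [ae_all_iff.2 hX.ae_apply_mem_Icc] with ω h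
  exact ⟨Finset.prod_nonneg fun t _ => pow_nonneg (h t).1 _,
    Finset.prod_le_one (fun t _ => pow_nonneg (h t).1 _) fun t _ => pow_le_one₀ (h t).1 (h t).2⟩

lemma moment_pos (n : T → ℕ) : 0 < moment μ X n := by
  have hpos : ∀ᵐ ω ∂μ, 0 < ∏ t, X ω t ^ n t :=
    hX.pos.mono fun ω h => Finset.prod_pos fun t _ => pow_pos (h t) _
  have hsupport : Function.support (fun ω => ∏ t, X ω t ^ n t) =ᵐ[μ] Set.univ :=
    Filter.eventuallyEq_univ.2 (hpos.mono fun ω h => h.ne')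
  refine (integral_pos_iff_support_of_nonneg_ae (hpos.mono fun ω h => h.le)
    (hX.integrable_prod_pow n)).2 ?_
  simp [measure_congr hsupport]

variable [DecidableEq T]

omit [DecidableEq T] in
lemma integral_pos (t : T) : 0 < ∫ ω, X ω t ∂μ := by
  classical
  exact moment_single X t ▸ hX.moment_pos _

lemma isSimplexMoments : IsSimplexMoments (moment μ X) where
  zero := by simp [moment]
  pos := hX.moment_pos
  sum_add_single n := by
    unfold moment
    rw [← integral_finsetSum _ fun t _ => hX.integrable_prod_pow _]
    refine integral_congr_ae (hX.sum_eq_one.mono fun ω h => ?_)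
    simp only [prod_pow_add_single, ← Finset.mul_sum, h, mul_one]

/-- Without reinforcement the second moment of `X t` is the square of the first one, so that its
variance vanishes. -/
lemma ae_eq_integral_of_polyaRecursion_zero {a : T → ℝ} (ha : ∑ t, a t ≠ 0)
    (h : PolyaRecursion 0 a (moment μ X)) : ∀ᵐ ω ∂μ, ∀ t, X ω t = ∫ ω, X ω t ∂μ := by
  refine ae_all_iff.2 fun t => ?_
  have hL2 : MemLp (fun ω => X ω t) 2 μ := memLp_of_bounded (hX.ae_apply_mem_Icc t)
    (hX.measurable_apply t).aestronglyMeasurable 2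
  refine ae_eq_integral_of_variance_eq_zero hL2 ?_
  have hfirst := h 0 t
  have hsecond := h (Pi.single t 1) t
  have hsq : moment μ X (Pi.single t 1 + Pi.single t 1) = ∫ ω, X ω t ^ 2 ∂μ := by
    refine integral_congr_ae (.of_forall fun ω => ?_)
    have hsingle := prod_pow_add_single (X ω) 0 t
    simp only [Pi.zero_apply, pow_zero, Finset.prod_const_one, zero_add, one_mul] at hsingle
    simp only [prod_pow_add_single, hsingle, sq]
  simp only [zero_mul, add_zero, zero_add, hX.isSimplexMoments.zero, one_mul] at hfirst hsecond
  rw [variance_eq_sub hL2, Pi.pow_def, ← hsq, ← moment_single, sub_eq_zero]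
  refine mul_right_cancel₀ ha ?_
  rw [hsecond, ← hfirst]
  ring

end IsRandomSimplex

end RandomSimplex

section Pushforward

variable {S T U M : Type*} [Fintype S] [DecidableEq T] [DecidableEq U] [AddCommMonoid M]

/-- The table of the sums of `q` over the fibers of `f`. The marginals of a table are its
pushforwards along restriction maps. -/
def pushforward (f : S → T) (q : S → M) (t : T) : M :=
  ∑ s with f s = t, q s

lemma pushforward_pushforward [Fintype T] (g : T → U) (f : S → T) (q : S → M) :
    pushforward g (pushforward f q) = pushforward (g ∘ f) q := by
  ext u
  unfold pushforward
  rw [← Finset.sum_fiberwise_of_maps_to (s := Finset.univ.filter fun s => (g ∘ f) s = u)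
    (t := Finset.univ.filter fun t => g t = u) (g := f) (by simp)]
  refine Finset.sum_congr rfl fun t ht => ?_
  rw [Finset.filter_filter]
  refine Finset.sum_congr (Finset.filter_congr fun s _ => ?_) fun _ _ => rfl
  rw [Finset.mem_filter] at ht
  constructor
  · rintro rfl
    exact ⟨ht.2, rfl⟩
  · exact And.right

lemma pushforward_comp_apply_of_injective {g : T → U} (hg : g.Injective) (f : S → T) (q : S → M)
    (t : T) : pushforward (g ∘ f) q (g t) = pushforward f q t := by
  simp only [pushforward, Function.comp_apply, hg.eq_iff]

lemma sum_pushforward [Fintype T] (f : S → T) (q : S → M) :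
    ∑ t, pushforward f q t = ∑ s, q s :=
  Finset.sum_fiberwise Finset.univ f q

omit [DecidableEq T] in
lemma pushforward_fst [DecidableEq S] [Fintype T] (q : S × T → M) (s : S) :
    pushforward Prod.fst q s = ∑ t, q (s, t) := by
  rw [pushforward, Finset.sum_filter, Fintype.sum_prod_type,
    Fintype.sum_eq_single s fun s' hs => by simp [hs]]
  simp

omit [DecidableEq T] [DecidableEq U] in
lemma pushforward_snd [Fintype T] [DecidableEq T] (q : S × T → M) (t : T) :
    pushforward Prod.snd q t = ∑ s, q (s, t) := by
  rw [pushforward, Finset.sum_filter, Fintype.sum_prod_type]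
  simp

lemma pushforward_pos {f : S → T} (hf : f.Surjective) {q : S → ℝ} (hq : ∀ s, 0 < q s) (t : T) :
    0 < pushforward f q t := by
  obtain ⟨s, hs⟩ := hf t
  exact Finset.sum_pos (fun s _ => hq s) ⟨s, by simpa using hs⟩

lemma prod_pow_comp {N : Type*} [CommMonoid N] [Fintype T] (f : S → T) (φ : T → N) (r : S → ℕ) :
    ∏ s, φ (f s) ^ r s = ∏ t, φ t ^ pushforward f r t := by
  rw [← Finset.prod_fiberwise Finset.univ f]
  refine Finset.prod_congr rfl fun t _ => ?_
  rw [pushforward, ← Finset.prod_pow_eq_pow_sum]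
  exact Finset.prod_congr rfl fun s hs => by rw [(Finset.mem_filter.1 hs).2]

lemma measurable_pushforward (f : S → T) : Measurable fun q : S → ℝ => pushforward f q :=
  measurable_pi_lambda _ fun _ => Finset.measurable_fun_sum _ fun s _ => measurable_pi_apply s

variable {Ω : Type*} [MeasurableSpace Ω] {μ : Measure Ω}

lemma IsRandomSimplex.pushforward [Fintype T] {X : Ω → S → ℝ} (hX : IsRandomSimplex μ X)
    {f : S → T} (hf : f.Surjective) : IsRandomSimplex μ fun ω => pushforward f (X ω) where
  measurable := (measurable_pushforward f).comp hX.measurable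
  pos := hX.pos.mono fun _ h => pushforward_pos hf h
  sum_eq_one := hX.sum_eq_one.mono fun ω h => by rw [sum_pushforward, h]

lemma IsRandomSimplex.integral_pushforward [IsProbabilityMeasure μ] {X : Ω → S → ℝ}
    (hX : IsRandomSimplex μ X) (f : S → T) (t : T) :
    ∫ ω, GraphDirichlet.pushforward f (X ω) t ∂μ =
      GraphDirichlet.pushforward f (fun s => ∫ ω, X ω s ∂μ) t :=
  integral_finsetSum _ fun s _ => hX.integrable_apply s

end Pushforward

section IndependentRows

variable {Ω : Type*} [MeasurableSpace Ω] {μ : Measure Ω}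
variable {S T : Type*} [Fintype T]

/-- The conditional distributions of the second index given the first one, for a table `x` of
probabilities of pairs. -/
noncomputable def condRow (x : S × T → ℝ) (s : S) (t : T) : ℝ :=
  x (s, t) / ∑ t', x (s, t')

/-- The rows of the random table `X`, normalized to sum one, are mutually independent, and
independent of the vector of the row sums. -/
structure HasIndependentRows (μ : Measure Ω) (X : Ω → S × T → ℝ) : Prop where
  indepFun : IndepFun (fun ω s => ∑ t, X ω (s, t)) (fun ω => condRow (X ω)) μ
  iIndepFun : iIndepFun (fun s ω => condRow (X ω) s) μ

lemma measurable_condRow (s : S) : Measurable fun x : S × T → ℝ => condRow x s :=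
  measurable_pi_lambda _ fun t => (measurable_pi_apply (s, t)).div
    (Finset.measurable_fun_sum _ fun t' _ => measurable_pi_apply (s, t'))

lemma HasIndependentRows.reindex {S' : Type*} {X : Ω → S × T → ℝ} (hX : HasIndependentRows μ X)
    {e : S' → S} (he : e.Injective) :
    HasIndependentRows μ fun ω a => X ω (e a.1, a.2) where
  indepFun := hX.indepFun.comp (φ := fun (x : S → ℝ) s => x (e s))
    (ψ := fun (y : S → T → ℝ) s => y (e s)) (by fun_prop) (by fun_prop)
  iIndepFun := hX.iIndepFun.precomp he

variable [Fintype S]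

lemma IsRandomSimplex.condRow [Nonempty T] {X : Ω → S × T → ℝ} (hX : IsRandomSimplex μ X) (s : S) :
    IsRandomSimplex μ fun ω => condRow (X ω) s where
  measurable := (measurable_condRow s).comp hX.measurable
  pos := hX.pos.mono fun _ h t => div_pos (h _)
    (Finset.sum_pos (fun t' _ => h (s, t')) Finset.univ_nonempty)
  sum_eq_one := hX.pos.mono fun _ h => by
    simp only [GraphDirichlet.condRow]
    rw [← Finset.sum_div, div_self
      (Finset.sum_pos (fun t' _ => h (s, t')) Finset.univ_nonempty).ne']

lemma prod_pow_eq_prod_sum_pow_mul [Nonempty T] {x : S × T → ℝ} (hx : ∀ a, 0 < x a)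
    (r : S × T → ℕ) : ∏ a, x a ^ r a =
      (∏ s, (∑ t, x (s, t)) ^ ∑ t, r (s, t)) * ∏ s, ∏ t, condRow x s t ^ r (s, t) := by
  rw [Fintype.prod_prod_type, ← Finset.prod_mul_distrib]
  refine Finset.prod_congr rfl fun s _ => ?_
  rw [← Finset.prod_pow_eq_pow_sum, ← Finset.prod_mul_distrib]
  refine Finset.prod_congr rfl fun t _ => ?_
  rw [← mul_pow, condRow, mul_div_cancel₀ _
    (Finset.sum_pos (fun t' _ => hx (s, t')) Finset.univ_nonempty).ne']

lemma measurable_prod_pow {T : Type*} [Fintype T] (n : T → ℕ) :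
    Measurable fun x : T → ℝ => ∏ t, x t ^ n t :=
  Finset.measurable_fun_prod _ fun t _ => (measurable_pi_apply t).pow_const _

lemma integral_prod_prod_pow {ι : Type*} [Fintype ι] {T : ι → Type*} [∀ x, Fintype (T x)]
    {X : ∀ x, Ω → T x → ℝ} (hind : iIndepFun X μ) (hX : ∀ x, Measurable (X x))
    (n : ∀ x, T x → ℕ) : ∫ ω, ∏ x, ∏ t, X x ω t ^ n x t ∂μ = ∏ x, moment μ (X x) (n x) :=
  hind.integral_fun_prod_comp (𝕜 := ℝ) (f := fun x v => ∏ t, v t ^ n x t)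
    (fun x => (hX x).aemeasurable) fun x => (measurable_prod_pow (n x)).aestronglyMeasurable

variable [DecidableEq S] [DecidableEq T] [IsProbabilityMeasure μ]

theorem HasIndependentRows.isRowFactorization [Nonempty T] {X : Ω → S × T → ℝ}
    (h : HasIndependentRows μ X) (hX : IsRandomSimplex μ X) :
    IsRowFactorization (moment μ X) (moment μ fun ω s => ∑ t, X ω (s, t))
      fun s => moment μ fun ω => condRow (X ω) s where
  left := by
    have := (hX.pushforward Prod.fst_surjective).isSimplexMoments
    simpa only [← pushforward_fst] using this
  row s := (hX.condRow s).isSimplexMoments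
  eq_mul_prod r := by
    rw [← integral_prod_prod_pow h.iIndepFun fun s => (hX.condRow s).measurable]
    refine Eq.trans (integral_congr_ae (hX.pos.mono fun ω hω =>
      prod_pow_eq_prod_sum_pow_mul hω r)) ?_
    have hsums : Measurable fun ω s => ∑ t, X ω (s, t) := measurable_pi_lambda _ fun s =>
      Finset.measurable_fun_sum _ fun t _ => hX.measurable_apply (s, t)
    have hrows : Measurable fun ω => GraphDirichlet.condRow (X ω) :=
      measurable_pi_lambda _ fun s => (hX.condRow s).measurable
    have hleft : Measurable fun x : S → ℝ => ∏ s, x s ^ ∑ t, r (s, t) := measurable_prod_pow _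
    have hright : Measurable fun y : S → T → ℝ => ∏ s, ∏ t, y s t ^ r (s, t) :=
      Finset.measurable_fun_prod _ fun s _ =>
        (measurable_prod_pow fun t => r (s, t)).comp (measurable_pi_apply s)
    exact h.indepFun.integral_fun_comp_mul_comp hsums.aemeasurable hrows.aemeasurable
      hleft.aestronglyMeasurable hright.aestronglyMeasurable

end IndependentRows

section Cells

variable {V : Type*} [DecidableEq V] {I : V → Type*}

/-- A cell of `insert w D` consists of a cell of `D` and an element of `I w`. -/
def consCell {D : Finset V} {w : V} (hw : w ∉ D) :
    (∀ u : D, I u) × I w ≃ (∀ u : (insert w D : Finset V), I u) where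
  toFun k x := if h : x.1 = w then cast (by rw [h]) k.2 else
    k.1 ⟨x.1, Finset.mem_of_mem_insert_of_ne x.2 h⟩
  invFun c := (Finset.restrict₂ (Finset.subset_insert w D) c, c ⟨w, Finset.mem_insert_self w D⟩)
  left_inv := by
    rintro ⟨k, l⟩
    ext x
    · have : x.1 ≠ w := fun h => hw (h ▸ x.2)
      simp [this]
    · simp
  right_inv c := by
    ext ⟨x, hx⟩
    by_cases h : x = w
    · subst h
      simp
    · simp [h]

lemma restrict_insert_eq_consCell_comp {D : Finset V} {w : V} (hw : w ∉ D) :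
    (insert w D).restrict = consCell (I := I) hw ∘ fun i => (D.restrict i, i w) :=
  funext fun _ => ((consCell hw).apply_symm_apply _).symm

omit [DecidableEq V]

/-- The cells of a single vertex. -/
def singletonCell (u : V) : I u ≃ (∀ x : ({u} : Finset V), I x) :=
  (Equiv.piUnique fun x : ({u} : Finset V) => I x).symm

lemma restrict_singleton_eq_singletonCell_comp (u : V) :
    Finset.restrict {u} = singletonCell (I := I) u ∘ Function.eval u :=
  funext fun _ => ((singletonCell u).apply_symm_apply _).symm

lemma restrict_surjective [Nonempty (∀ v, I v)] (D : Finset V) :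
    Function.Surjective (D.restrict : (∀ v, I v) → ∀ u : D, I u) := by
  classical
  exact fun k => ⟨fun v => if h : v ∈ D then k ⟨v, h⟩ else Classical.arbitrary (∀ v, I v) v,
    by ext x; simp⟩

lemma restrict_prodMk_eval_surjective [Nonempty (∀ v, I v)] {D : Finset V} {w : V} (hw : w ∉ D) :
    Function.Surjective fun i : ∀ v, I v => (D.restrict i, i w) := by
  classical
  have h := restrict_surjective (I := I) (insert w D)
  rw [restrict_insert_eq_consCell_comp hw] at h
  exact h.of_comp_left (consCell hw).injective

lemma eval_prodMk_eval_surjective [Nonempty (∀ v, I v)] {u w : V} (h : u ≠ w) :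
    Function.Surjective fun i : ∀ v, I v => (i u, i w) := by
  classical
  exact fun a => ⟨Function.update (Function.update (Classical.arbitrary _) u a.1) w a.2,
    by simp [h]⟩

end Cells

section Families

variable {V : Type*} [Fintype V] [DecidableEq V]
variable {I : V → Type*} [∀ v, Fintype (I v)] [∀ v, DecidableEq (I v)]
variable {M : Type*} [AddCommMonoid M]

/-- The joint marginal of a table at the vertices of `D`, as one index, and at the vertex `w`. Its
normalized rows are the conditional probabilities at `w` given the values on `D`. -/
def familyTable (q : (∀ v, I v) → M) (w : V) (D : Finset V) : (∀ u : D, I u) × I w → M :=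
  pushforward (fun i => (D.restrict i, i w)) q

/-- The joint marginal of a table at two vertices. -/
def edgeTable (q : (∀ v, I v) → M) (u w : V) : I u × I w → M :=
  pushforward (fun i => (i u, i w)) q

lemma marginal_eq_pushforward (q : (∀ v, I v) → M) (D : Finset V) :
    marginal q D = pushforward D.restrict q :=
  rfl

lemma sum_marginal_restrict₂ (q : (∀ v, I v) → M) {S C : Finset V} (h : S ⊆ C)
    (s : ∀ u : S, I u) :
    ∑ k with Finset.restrict₂ h k = s, marginal q C k = marginal q S s :=
  congrFun (pushforward_pushforward (Finset.restrict₂ h) C.restrict q) s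

lemma sum_familyTable (q : (∀ v, I v) → M) (w : V) (D : Finset V) (k : ∀ u : D, I u) :
    ∑ l, familyTable q w D (k, l) = marginal q D k := by
  rw [← pushforward_fst, familyTable, pushforward_pushforward]
  rfl

lemma sum_edgeTable (q : (∀ v, I v) → M) (u w : V) (k : I u) :
    ∑ l, edgeTable q u w (k, l) = pushforward (Function.eval u) q k := by
  rw [← pushforward_fst, edgeTable, pushforward_pushforward]
  rfl

lemma edgeTable_swap (q : (∀ v, I v) → M) (u w : V) (a : I u × I w) :
    edgeTable q w u a.swap = edgeTable q u w a :=
  pushforward_comp_apply_of_injective Prod.swap_injective (fun i : ∀ v, I v => (i u, i w)) q a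

lemma marginal_consCell (q : (∀ v, I v) → M) {w : V} {D : Finset V} (hw : w ∉ D)
    (a : (∀ u : D, I u) × I w) : marginal q (insert w D) (consCell hw a) = familyTable q w D a := by
  rw [marginal_eq_pushforward, restrict_insert_eq_consCell_comp hw,
    pushforward_comp_apply_of_injective (consCell hw).injective, familyTable]

lemma marginal_singletonCell (q : (∀ v, I v) → M) (u : V) (k : I u) :
    marginal q {u} (singletonCell u k) = pushforward (Function.eval u) q k := by
  rw [marginal_eq_pushforward, restrict_singleton_eq_singletonCell_comp,
    pushforward_comp_apply_of_injective (singletonCell u).injective]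

lemma marginal_empty (q : (∀ v, I v) → M) (k : ∀ u : (∅ : Finset V), I u) :
    marginal q ∅ k = ∑ i, q i := by
  rw [marginal, Finset.filter_true_of_mem fun i _ => Subsingleton.elim _ _]

lemma familyTable_singletonCell (q : (∀ v, I v) → M) (u w : V) (a : I u × I w) :
    familyTable q w {u} (singletonCell u a.1, a.2) = edgeTable q u w a := by
  refine Eq.trans ?_ (pushforward_comp_apply_of_injective
    ((singletonCell u).injective.prodMap Function.injective_id) (fun i => (i u, i w)) q a)
  rw [familyTable, restrict_singleton_eq_singletonCell_comp]
  rfl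

lemma familyTable_empty (q : (∀ v, I v) → M) (w : V) (a : (∀ u : (∅ : Finset V), I u) × I w) :
    familyTable q w ∅ a = pushforward (Function.eval w) q a.2 := by
  refine Eq.trans ?_ (pushforward_comp_apply_of_injective
    (Prod.mk_right_injective a.1) (Function.eval w) q a.2)
  rw [familyTable]
  congr 1
  ext i : 1
  exact Prod.ext (Subsingleton.elim _ _) rfl

lemma condProb_eq_condRow (q : (∀ v, I v) → ℝ) (w : V) (D : Finset V) (k : ∀ u : D, I u) :
    condProb q w D k = condRow (familyTable q w D) k := by
  ext l
  rw [condRow, sum_familyTable]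
  simp only [condProb, familyTable, pushforward, Prod.mk.injEq]

lemma sum_marginal_mul_condProb {q : (∀ v, I v) → ℝ} (w : V) {D : Finset V}
    (hq : ∀ k, marginal q D k ≠ 0) (l : I w) :
    ∑ k, marginal q D k * condProb q w D k l = pushforward (Function.eval w) q l := by
  simp only [condProb_eq_condRow, condRow, sum_familyTable, mul_div_cancel₀ _ (hq _)]
  rw [← pushforward_snd, familyTable, pushforward_pushforward]
  rfl

variable {G : SimpleGraph V} [DecidableRel G.Adj] [Nontrivial V]

lemma eq_prod_condProb (hG : G.IsTree) {K : ℕ} {C : Fin K → Finset V} (hC : IsPerfectOrder G C)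
    (r : V) {q : (∀ v, I v) → ℝ} (hq : ∀ i, 0 < q i) (i : ∀ v, I v)
    (h : q i = (∏ l, marginal q (C l) ((C l).restrict i)) /
      ∏ l, marginal q (separator C l) ((separator C l).restrict i)) :
    q i = ∏ w, condProb q w (rootedParents G r w) ((rootedParents G r w).restrict i) (i w) := by
  have : Nonempty (∀ v, I v) := ⟨i⟩
  rw [h, hC.prod_div_prod_separator hG r (F := fun D => marginal q D (D.restrict i))
    fun D => (pushforward_pos (restrict_surjective D) hq _).ne']
  refine Finset.prod_congr rfl fun w _ => ?_
  rw [condProb_eq_condRow, condRow, sum_familyTable,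
    ← marginal_consCell q (notMem_rootedParents_self r w),
    restrict_insert_eq_consCell_comp (notMem_rootedParents_self r w), Function.comp_apply]

lemma prod_pow_eq_prod_condProb (hG : G.IsTree) {K : ℕ} {C : Fin K → Finset V}
    (hC : IsPerfectOrder G C) (ρ : V) {q : (∀ v, I v) → ℝ} (hq : ∀ i, 0 < q i)
    (h : ∀ i, q i = (∏ l, marginal q (C l) ((C l).restrict i)) /
      ∏ l, marginal q (separator C l) ((separator C l).restrict i)) (r : (∀ v, I v) → ℕ) :
    ∏ i, q i ^ r i = ∏ w, ∏ k, ∏ l, condProb q w (rootedParents G ρ w) k l ^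
      familyTable r w (rootedParents G ρ w) (k, l) := by
  simp only [← Fintype.prod_prod_type']
  rw [Finset.prod_congr rfl fun i _ => by rw [eq_prod_condProb hG hC ρ hq i (h i)]]
  simp only [← Finset.prod_pow]
  rw [Finset.prod_comm]
  exact Finset.prod_congr rfl fun w _ => prod_pow_comp
    (fun i => ((rootedParents G ρ w).restrict i, i w))
    (fun a => condProb q w (rootedParents G ρ w) a.1 a.2) r

end Families

lemma measurable_sum_mul {Ω S T : Type*} [MeasurableSpace Ω] [Fintype S] {f : Ω → S → ℝ}
    {g : S → Ω → T → ℝ} (hf : Measurable f) (hg : ∀ s, Measurable (g s)) :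
    Measurable fun ω t => ∑ s, f ω s * g s ω t :=
  measurable_pi_lambda _ fun t => Finset.measurable_fun_sum _ fun s _ =>
    ((measurable_pi_apply s).comp hf).mul ((measurable_pi_apply t).comp (hg s))

section ParameterAlgebra

variable {V : Type*} [Fintype V] [DecidableEq V]
variable {I : V → Type*} [∀ v, Fintype (I v)] [∀ v, DecidableEq (I v)]
variable {Ω : Type*} [mΩ : MeasurableSpace Ω] {μ : Measure Ω} {p : Ω → (∀ v, I v) → ℝ}

/-- The random conditional distributions at the vertices given their parents, indexed by a vertex
and a cell of its parents. -/
noncomputable def parameter (p : Ω → (∀ v, I v) → ℝ) (𝔭 : V → Finset V)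
    (x : Σ v : V, (∀ u : 𝔭 v, I u)) (ω : Ω) : I x.1 → ℝ :=
  condProb (p ω) x.1 (𝔭 x.1) x.2

/-- The σ-algebra generated by the parameters at the vertices of `W`. -/
@[reducible]
noncomputable def parameterAlgebra (p : Ω → (∀ v, I v) → ℝ) (𝔭 : V → Finset V) (W : Set V) :
    MeasurableSpace Ω :=
  ⨆ x ∈ {x : Σ v : V, (∀ u : 𝔭 v, I u) | x.1 ∈ W},
    MeasurableSpace.comap (parameter p 𝔭 x) inferInstance

omit mΩ in
lemma parameterAlgebra_mono (𝔭 : V → Finset V) {W W' : Set V} (h : W ⊆ W') :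
    parameterAlgebra p 𝔭 W ≤ parameterAlgebra p 𝔭 W' :=
  biSup_mono fun _ hx => h hx

omit mΩ in
lemma measurable_condProb_parameterAlgebra {𝔭 : V → Finset V} {W : Set V} {w : V} (hw : w ∈ W)
    (k : ∀ u : 𝔭 w, I u) :
    Measurable[parameterAlgebra p 𝔭 W] fun ω => condProb (p ω) w (𝔭 w) k :=
  measurable_iff_comap_le.2 (le_biSup (fun x => MeasurableSpace.comap (parameter p 𝔭 x)
    inferInstance) (show (⟨w, k⟩ : Σ v : V, (∀ u : 𝔭 v, I u)) ∈ {x | x.1 ∈ W} from hw))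

lemma measurable_condProb (hp : Measurable p) (w : V) (D : Finset V) (k : ∀ u : D, I u) :
    Measurable fun ω => condProb (p ω) w D k := by
  simp only [condProb_eq_condRow]
  exact (measurable_condRow k).comp ((measurable_pushforward _).comp hp)

lemma indep_parameterAlgebra (hp : Measurable p) {𝔭 : V → Finset V}
    (hind : iIndepFun (parameter p 𝔭) μ) {W W' : Set V} (h : Disjoint W W') :
    Indep (parameterAlgebra p 𝔭 W) (parameterAlgebra p 𝔭 W') μ :=
  have hle (x : Σ v : V, (∀ u : 𝔭 v, I u)) :
      MeasurableSpace.comap (parameter p 𝔭 x) inferInstance ≤ mΩ :=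
    (measurable_condProb hp _ _ x.2).comap_le
  indep_iSup_of_disjoint hle hind.iIndep (Disjoint.preimage Sigma.fst h)

variable {G : SimpleGraph V} [DecidableRel G.Adj]

lemma exists_measurable_marginal_rootedParents [Nonempty (∀ v, I v)] (hp : IsRandomSimplex μ p)
    (hG : G.IsTree) (r w : V) :
    ∃ f : Ω → (∀ u : rootedParents G r w, I u) → ℝ,
      Measurable[parameterAlgebra p (rootedParents G r) {v | G.dist r v < G.dist r w}] f ∧
        (fun ω => marginal (p ω) (rootedParents G r w)) =ᵐ[μ] f := by
  induction hd : G.dist r w using Nat.strong_induction_on generalizing w with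
  | _ d ih =>
  subst hd
  rcases eq_or_ne w r with rfl | hw
  · refine ⟨fun _ _ => 1, measurable_const, hp.sum_eq_one.mono fun ω h => ?_⟩
    rw [rootedParents_self]
    exact funext fun k => (marginal_empty (p ω) k).trans h
  · obtain ⟨u, hu⟩ := exists_rootedParents_eq_singleton hG hw
    have hlt : G.dist r u < G.dist r w := by
      have := (mem_rootedParents.1 (hu ▸ Finset.mem_singleton_self u :
        u ∈ rootedParents G r w)).2
      lia
    obtain ⟨f, hf, hpf⟩ := ih _ hlt u rfl
    have hmono := parameterAlgebra_mono (p := p) (rootedParents G r)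
      (W := {v | G.dist r v < G.dist r u}) (W' := {v | G.dist r v < G.dist r w})
      fun v hv => lt_trans hv hlt
    rw [hu]
    refine ⟨fun ω c => ∑ k, f ω k *
      condProb (p ω) u (rootedParents G r u) k ((singletonCell u).symm c), ?_, ?_⟩
    · have hmul : Measurable[parameterAlgebra p (rootedParents G r) {v | G.dist r v < G.dist r w}]
          fun ω l => ∑ k, f ω k * condProb (p ω) u (rootedParents G r u) k l :=
        @measurable_sum_mul _ _ _ (_) _ f (fun k ω => condProb (p ω) u (rootedParents G r u) k)
          (hf.mono hmono le_rfl) fun k => measurable_condProb_parameterAlgebra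
            (𝔭 := rootedParents G r) (W := {v | G.dist r v < G.dist r w}) hlt k
      exact (measurable_pi_lambda _ fun c =>
        measurable_pi_apply ((singletonCell u).symm c)).comp hmul
    · filter_upwards [hpf, hp.pos] with ω hfω hpos
      ext c
      obtain ⟨l, rfl⟩ := (singletonCell u).surjective c
      rw [marginal_singletonCell, Equiv.symm_apply_apply, ← hfω, sum_marginal_mul_condProb]
      exact fun k => (pushforward_pos (restrict_surjective _) hpos k).ne'

theorem hasIndependentRows_familyTable [Nonempty (∀ v, I v)] (hp : IsRandomSimplex μ p)
    (hG : G.IsTree) (r w : V) (hind : iIndepFun (parameter p (rootedParents G r)) μ) :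
    HasIndependentRows μ fun ω => familyTable (p ω) w (rootedParents G r w) where
  indepFun := by
    obtain ⟨f, hf, hpf⟩ := exists_measurable_marginal_rootedParents hp hG r w
    have hrows : Measurable[parameterAlgebra p (rootedParents G r) {w}]
        fun ω k => condProb (p ω) w (rootedParents G r w) k :=
      @measurable_pi_lambda _ _ _ (_) _ _ fun k =>
        measurable_condProb_parameterAlgebra (Set.mem_singleton w) k
    have hindep := indep_parameterAlgebra hp.measurable hind
      (W := {v | G.dist r v < G.dist r w}) (W' := {w}) (by simp)
    have hfun := (IndepFun_iff_Indep f _ μ).2 (indep_of_indep_of_le_left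
      (indep_of_indep_of_le_right hindep hrows.comap_le) hf.comap_le)
    simpa only [sum_familyTable, condProb_eq_condRow] using hfun.congr hpf.symm (.refl _ _)
  iIndepFun := by
    have hrows : iIndepFun (fun k ω => condProb (p ω) w (rootedParents G r w) k) μ :=
      hind.precomp (sigma_mk_injective (i := w))
    simpa only [condProb_eq_condRow] using hrows

end ParameterAlgebra

section PolyaMoments

variable {Ω : Type*} [MeasurableSpace Ω] {μ : Measure Ω}
variable {S T : Type*} [Fintype S] [Fintype T] [DecidableEq T]

/-- The moments of `X` satisfy the recursion of a Pólya urn with reinforcement `κ` that starts with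
the weights `𝔼 X`. For a random vector in the simplex with `κ > 0` this says that `X` is Dirichlet
of total mass `κ⁻¹`. -/
def HasPolyaMoments (μ : Measure Ω) (κ : ℝ) (X : Ω → T → ℝ) : Prop :=
  PolyaRecursion κ (fun t => ∫ ω, X ω t ∂μ) (moment μ X)

variable [DecidableEq S]

lemma HasPolyaMoments.reindex {κ : ℝ} {X : Ω → T → ℝ} (h : HasPolyaMoments μ κ X) (e : S ≃ T) :
    HasPolyaMoments μ κ fun ω s => X ω (e s) := by
  have hmoment (n : S → ℕ) : moment μ (fun ω s => X ω (e s)) n = moment μ X (n ∘ e.symm) := by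
    unfold moment
    congr with ω
    rw [← e.prod_comp]
    simp
  intro n s
  have hadd : (n + Pi.single s 1) ∘ e.symm = n ∘ e.symm + Pi.single (e s) 1 := by
    funext t
    simp [Pi.single_apply, e.symm_apply_eq]
  have hs := h (n ∘ e.symm) (e s)
  rw [← e.sum_comp] at hs
  simpa only [hmoment, hadd, Function.comp_apply, e.symm_apply_apply] using hs

variable [IsProbabilityMeasure μ] [Nonempty T] {X : Ω → S × T → ℝ} {κ : ℝ}

lemma HasIndependentRows.hasPolyaMoments_sum (hrows : HasIndependentRows μ X)
    (hX : IsRandomSimplex μ X) (h : HasPolyaMoments μ κ X) :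
    HasPolyaMoments μ κ fun ω s => ∑ t, X ω (s, t) := by
  have hleft := (hrows.isRowFactorization hX).polyaRecursion_left h
  simpa only [HasPolyaMoments, integral_finsetSum _ fun _ _ => hX.integrable_apply _] using hleft

lemma HasIndependentRows.polyaRecursion_condRow (hrows : HasIndependentRows μ X)
    (hX : IsRandomSimplex μ X) (h : HasPolyaMoments μ κ X) (s : S) :
    PolyaRecursion κ (fun t => ∫ ω, X ω (s, t) ∂μ) (moment μ fun ω => condRow (X ω) s) :=
  (hrows.isRowFactorization hX).polyaRecursion_row h s

end PolyaMoments

section TreeMarginals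

variable {V : Type*} [Fintype V] [DecidableEq V]
variable {I : V → Type*} [∀ v, Fintype (I v)] [∀ v, DecidableEq (I v)]
variable {Ω : Type*} [MeasurableSpace Ω] {μ : Measure Ω} {p : Ω → (∀ v, I v) → ℝ}
variable [Nonempty (∀ v, I v)]

lemma IsRandomSimplex.familyTable (hp : IsRandomSimplex μ p) {w : V} {D : Finset V} (hw : w ∉ D) :
    IsRandomSimplex μ fun ω => familyTable (p ω) w D :=
  hp.pushforward (restrict_prodMk_eval_surjective hw)

lemma IsRandomSimplex.condProb (hp : IsRandomSimplex μ p) {w : V} {D : Finset V} (hw : w ∉ D)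
    (k : ∀ u : D, I u) : IsRandomSimplex μ fun ω => condProb (p ω) w D k := by
  have : Nonempty (I w) := ‹Nonempty (∀ v, I v)›.map fun i => i w
  simpa only [condProb_eq_condRow] using (hp.familyTable hw).condRow k

lemma ParameterIndependence.nontrivial {𝔭 : V → Finset V} (h : ParameterIndependence μ p 𝔭)
    (hp : IsRandomSimplex μ p) {v : V} (hv : v ∉ 𝔭 v) : Nontrivial (I v) := by
  obtain ⟨k⟩ : Nonempty (∀ u : 𝔭 v, I u) := ‹Nonempty (∀ v, I v)›.map (𝔭 v).restrict
  by_contra hI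
  rw [not_nontrivial_iff_subsingleton] at hI
  refine h.2 v k ⟨1, (hp.condProb hv k).sum_eq_one.mono fun ω hω => funext fun l => ?_⟩
  rwa [Fintype.sum_eq_single l fun l' hl => absurd (Subsingleton.elim l' l) hl] at hω

lemma IsRandomSimplex.edgeTable (hp : IsRandomSimplex μ p) {u w : V} (h : u ≠ w) :
    IsRandomSimplex μ fun ω => edgeTable (p ω) u w :=
  hp.pushforward (eval_prodMk_eval_surjective h)

variable [IsProbabilityMeasure μ]

/-- A parameter with Pólya moments of reinforcement zero would be almost surely constant. -/
lemma ParameterIndependence.ne_zero_of_polyaRecursion {𝔭 : V → Finset V}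
    (h : ParameterIndependence μ p 𝔭) (hp : IsRandomSimplex μ p) {v : V} (hv : v ∉ 𝔭 v)
    (k : ∀ u : 𝔭 v, I u) {κ : ℝ} {a : I v → ℝ} (ha : ∑ l, a l ≠ 0)
    (hκ : PolyaRecursion κ a (moment μ fun ω => condProb (p ω) v (𝔭 v) k)) : κ ≠ 0 := by
  rintro rfl
  exact h.2 v k ⟨_, ((hp.condProb hv k).ae_eq_integral_of_polyaRecursion_zero ha hκ).mono
    fun _ => funext⟩

variable {G : SimpleGraph V} [DecidableRel G.Adj] (hp : IsRandomSimplex μ p) (hG : G.IsTree)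

include hp hG

lemma polyaRecursion_condProb {r w : V} (hind : iIndepFun (parameter p (rootedParents G r)) μ)
    {κ : ℝ} (h : HasPolyaMoments μ κ fun ω => familyTable (p ω) w (rootedParents G r w))
    (k : ∀ u : rootedParents G r w, I u) :
    PolyaRecursion κ (fun l => ∫ ω, familyTable (p ω) w (rootedParents G r w) (k, l) ∂μ)
      (moment μ fun ω => condProb (p ω) w (rootedParents G r w) k) := by
  have := Classical.nonempty_pi.1 ‹Nonempty (∀ v, I v)›
  simpa only [condProb_eq_condRow] using
    (hasIndependentRows_familyTable hp hG r w hind).polyaRecursion_condRow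
      (hp.familyTable (notMem_rootedParents_self r w)) h k

variable (hind : ∀ v, G.degree v = 1 → ParameterIndependence μ p (rootedParents G v))

include hind

omit [IsProbabilityMeasure μ] in
lemma hasIndependentRows_edgeTable {u w : V} (h : G.Adj u w) :
    HasIndependentRows μ fun ω => edgeTable (p ω) u w := by
  obtain ⟨r, hr, hparents⟩ := exists_leaf_rootedParents_eq hG h
  have hrows := hasIndependentRows_familyTable hp hG r w (hind r hr).1
  rw [hparents] at hrows
  simpa only [familyTable_singletonCell] using hrows.reindex (singletonCell u).injective

lemma hasPolyaMoments_eval {u w : V} (h : G.Adj u w) {κ : ℝ}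
    (hedge : HasPolyaMoments μ κ fun ω => edgeTable (p ω) u w) :
    HasPolyaMoments μ κ fun ω => pushforward (Function.eval u) (p ω) := by
  have := Classical.nonempty_pi.1 ‹Nonempty (∀ v, I v)›
  simpa only [sum_edgeTable] using
    (hasIndependentRows_edgeTable hp hG hind h).hasPolyaMoments_sum (hp.edgeTable h.ne) hedge

variable [Nontrivial V]

omit [IsProbabilityMeasure μ] in
lemma nontrivial_fiber (v : V) : Nontrivial (I v) := by
  obtain ⟨ρ, hρ⟩ := hG.exists_vert_degree_one_of_nontrivial
  exact (hind ρ hρ).nontrivial hp (notMem_rootedParents_self ρ v)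

lemma exists_hasPolyaMoments_edgeTable {u w : V} (h : G.Adj u w) :
    ∃ κ, 0 ≤ κ ∧ HasPolyaMoments μ κ fun ω => edgeTable (p ω) u w := by
  have := nontrivial_fiber hp hG hind
  have hcard : 3 ≤ ENat.card (I u × I w) := by
    rw [ENat.card_prod]
    have (v : V) : 2 ≤ ENat.card (I v) := Order.add_one_le_of_lt (ENat.one_lt_card (α := I v))
    exact le_trans (by norm_num) (mul_le_mul' (this u) (this w))
  have hX := hp.edgeTable h.ne
  have hswap : moment μ (fun ω => edgeTable (p ω) w u) =
      fun r => moment μ (fun ω => edgeTable (p ω) u w) (r ∘ Prod.swap) := by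
    funext r
    unfold moment
    congr with ω
    rw [← (Equiv.prodComm (I u) (I w)).prod_comp]
    simp only [Equiv.prodComm_apply, edgeTable_swap, Function.comp_apply]
  have hrows := (hasIndependentRows_edgeTable hp hG hind h).isRowFactorization hX
  have hcols := (hasIndependentRows_edgeTable hp hG hind h.symm).isRowFactorization
    (hp.edgeTable h.ne')
  rw [hswap] at hcols
  obtain ⟨κ, hκ, hrec⟩ :=
    (hrows.johnsonSufficient hcols).exists_polyaRecursion hcard hX.isSimplexMoments
  exact ⟨κ, hκ, by simpa only [HasPolyaMoments, moment_single] using hrec⟩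

/-- Neighbouring edges have the same reinforcement, since it is determined by the moments of their
common vertex. -/
lemma exists_forall_hasPolyaMoments_edgeTable :
    ∃ κ, 0 ≤ κ ∧ ∀ u w, G.Adj u w → HasPolyaMoments μ κ fun ω => edgeTable (p ω) u w := by
  have := nontrivial_fiber hp hG hind
  obtain ⟨v₀⟩ := hG.connected.nonempty
  obtain ⟨κ, hκ, hroot⟩ : ∃ κ, 0 ≤ κ ∧
      HasPolyaMoments μ κ fun ω => pushforward (Function.eval v₀) (p ω) := by
    obtain ⟨w, hw⟩ := hG.connected.preconnected.exists_adj_of_nontrivial v₀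
    obtain ⟨κ, hκ, hedge⟩ := exists_hasPolyaMoments_edgeTable hp hG hind hw
    exact ⟨κ, hκ, hasPolyaMoments_eval hp hG hind hw hedge⟩
  have hedge_of_eval {u w : V} (h : G.Adj u w)
      (hu : HasPolyaMoments μ κ fun ω => pushforward (Function.eval u) (p ω)) :
      HasPolyaMoments μ κ fun ω => edgeTable (p ω) u w := by
    obtain ⟨κ', -, hedge⟩ := exists_hasPolyaMoments_edgeTable hp hG hind h
    have hu' := hasPolyaMoments_eval hp hG hind h hedge
    rwa [PolyaRecursion.reinforcement_unique
      (hp.pushforward (Function.surjective_eval u)).isSimplexMoments hu hu']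
  refine ⟨κ, hκ, fun u w h => hedge_of_eval h ?_⟩
  obtain ⟨path⟩ := hG.connected v₀ u
  induction path with
  | nil => exact hroot
  | cons hadj _ ih =>
    have hedge := (hedge_of_eval hadj hroot).reindex (Equiv.prodComm _ _)
    simp only [Equiv.prodComm_apply, edgeTable_swap] at hedge
    exact ih (hasPolyaMoments_eval hp hG hind hadj.symm hedge) h

theorem exists_forall_hasPolyaMoments_familyTable :
    ∃ κ, 0 < κ ∧ ∀ r w, HasPolyaMoments μ κ fun ω => familyTable (p ω) w (rootedParents G r w) := by
  obtain ⟨κ, hκ, hedge⟩ := exists_forall_hasPolyaMoments_edgeTable hp hG hind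
  have hfamily (r w : V) :
      HasPolyaMoments μ κ fun ω => familyTable (p ω) w (rootedParents G r w) := by
    rcases eq_or_ne w r with rfl | hw
    · obtain ⟨u, hu⟩ := hG.connected.preconnected.exists_adj_of_nontrivial w
      rw [rootedParents_self]
      convert (hasPolyaMoments_eval hp hG hind hu (hedge w u hu)).reindex
        (Equiv.uniqueProd (I w) (∀ x : (∅ : Finset V), I x)) using 2 with ω
      exact funext (familyTable_empty (p ω) w)
    · obtain ⟨u, hu⟩ := exists_rootedParents_eq_singleton hG hw
      have hadj := (mem_rootedParents.1 (hu ▸ Finset.mem_singleton_self u)).1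
      rw [hu]
      convert (hedge u w hadj).reindex
        ((singletonCell u).symm.prodCongr (Equiv.refl (I w))) using 2 with ω
      ext a
      simp [← familyTable_singletonCell]
  obtain ⟨ρ, hρ⟩ := hG.exists_vert_degree_one_of_nontrivial
  obtain ⟨k⟩ : Nonempty (∀ u : rootedParents G ρ ρ, I u) :=
    ‹Nonempty (∀ v, I v)›.map (rootedParents G ρ ρ).restrict
  have := Classical.nonempty_pi.1 ‹Nonempty (∀ v, I v)›
  have hmem := notMem_rootedParents_self (G := G) ρ ρ
  have hmean := Finset.sum_pos (fun l _ => (hp.familyTable hmem).integral_pos (k, l))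
    (Finset.univ_nonempty (α := I ρ))
  have hne := (hind ρ hρ).ne_zero_of_polyaRecursion hp hmem k hmean.ne'
    (polyaRecursion_condProb hp hG (hind ρ hρ).1 (hfamily ρ ρ) k)
  exact ⟨κ, hκ.lt_of_ne' hne, hfamily⟩

end TreeMarginals

section HyperDirichlet

variable {V : Type*} [Fintype V] [DecidableEq V]
variable {I : V → Type*} [∀ v, Fintype (I v)] [∀ v, DecidableEq (I v)]

/-- The contribution of the vertex set `D` to the ratio `Z(α + r) / Z(α)` of normalizing constants,
for the hyperparameters `α^D` that are the marginals of a table `a`. -/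
noncomputable def gammaRatio (a : (∀ v, I v) → ℝ) (r : (∀ v, I v) → ℕ) (D : Finset V) : ℝ :=
  ∏ k, Real.Gamma (marginal a D k + marginal r D k) / Real.Gamma (marginal a D k)

lemma normConst_div_normConst {K : ℕ} (C : Fin K → Finset V) (a : (∀ v, I v) → ℝ)
    (r : (∀ v, I v) → ℕ) :
    normConst C (fun D k => marginal a D k + (marginal r D k : ℕ)) / normConst C (marginal a) =
      (∏ l, gammaRatio a r (C l)) / ∏ l, gammaRatio a r (separator C l) := by
  simp only [normConst, gammaRatio, Finset.prod_div_distrib]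
  exact div_div_div_comm _ _ _ _

lemma gammaRatio_insert_div {w : V} {D : Finset V} (hw : w ∉ D) (a : (∀ v, I v) → ℝ)
    (r : (∀ v, I v) → ℕ) : gammaRatio a r (insert w D) / gammaRatio a r D =
      ∏ k, dirichletMoment (fun l => familyTable a w D (k, l))
        fun l => familyTable r w D (k, l) := by
  simp only [gammaRatio, dirichletMoment]
  rw [← (consCell hw).prod_comp, Fintype.prod_prod_type, ← Finset.prod_div_distrib]
  simp only [marginal_consCell, Finset.sum_add_distrib, ← Nat.cast_sum, sum_familyTable]

section Positive

variable [Nonempty (∀ v, I v)] {a : (∀ v, I v) → ℝ} (ha : ∀ i, 0 < a i)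

include ha

lemma marginal_pos (D : Finset V) (k : ∀ u : D, I u) : 0 < marginal a D k :=
  pushforward_pos (restrict_surjective D) ha k

lemma isHyperparameter_marginal {K : ℕ} (C : Fin K → Finset V) :
    IsHyperparameter C (marginal a) where
  pos l := marginal_pos ha (C l)
  consistent _ _ := sum_marginal_restrict₂ a

lemma gammaRatio_pos (r : (∀ v, I v) → ℕ) (D : Finset V) : 0 < gammaRatio a r D :=
  Finset.prod_pos fun k _ => div_pos
    (Real.Gamma_pos_of_pos (add_pos_of_pos_of_nonneg (marginal_pos ha D k) (Nat.cast_nonneg _)))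
    (Real.Gamma_pos_of_pos (marginal_pos ha D k))

theorem normConst_div_normConst_eq_prod_dirichletMoment [Nontrivial V] {G : SimpleGraph V}
    [DecidableRel G.Adj] (hG : G.IsTree) {K : ℕ} {C : Fin K → Finset V} (hC : IsPerfectOrder G C)
    (ρ : V) (r : (∀ v, I v) → ℕ) :
    normConst C (fun D k => marginal a D k + (marginal r D k : ℕ)) / normConst C (marginal a) =
      ∏ w, ∏ k, dirichletMoment (fun l => familyTable a w (rootedParents G ρ w) (k, l))
        fun l => familyTable r w (rootedParents G ρ w) (k, l) := by
  rw [normConst_div_normConst,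
    hC.prod_div_prod_separator hG ρ fun D => (gammaRatio_pos ha r D).ne']
  exact Finset.prod_congr rfl fun w _ =>
    gammaRatio_insert_div (notMem_rootedParents_self ρ w) a r

end Positive

variable {Ω : Type*} [MeasurableSpace Ω] {μ : Measure Ω} {p : Ω → (∀ v, I v) → ℝ}
variable {G : SimpleGraph V} [DecidableRel G.Adj]

lemma integral_prod_pow_eq_prod_moment [Nontrivial V] (hp : IsRandomSimplex μ p) (hG : G.IsTree)
    {K : ℕ} {C : Fin K → Finset V} (hC : IsPerfectOrder G C)
    (hassoc : ∀ᵐ ω ∂μ, ∀ i, p ω i = (∏ l, marginal (p ω) (C l) ((C l).restrict i)) /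
      ∏ l, marginal (p ω) (separator C l) ((separator C l).restrict i)) {ρ : V}
    (hind : iIndepFun (parameter p (rootedParents G ρ)) μ) (r : (∀ v, I v) → ℕ) :
    ∫ ω, ∏ i, p ω i ^ r i ∂μ =
      ∏ w, ∏ k, moment μ (fun ω => condProb (p ω) w (rootedParents G ρ w) k)
        fun l => familyTable r w (rootedParents G ρ w) (k, l) := by
  have hprod := integral_prod_prod_pow hind (fun x => measurable_condProb hp.measurable _ _ x.2)
    fun x l => familyTable r x.1 (rootedParents G ρ x.1) (x.2, l)
  simp only [Fintype.prod_sigma] at hprod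
  refine (integral_congr_ae ?_).trans hprod
  filter_upwards [hp.pos, hassoc] with ω hpos h
  exact prod_pow_eq_prod_condProb hG hC ρ hpos h r

variable [IsProbabilityMeasure μ] [Nonempty (∀ v, I v)]

lemma moment_condProb_eq_dirichletMoment (hp : IsRandomSimplex μ p) (hG : G.IsTree) {r w : V}
    (hind : iIndepFun (parameter p (rootedParents G r)) μ) {κ : ℝ} (hκ : 0 < κ)
    (h : HasPolyaMoments μ κ fun ω => familyTable (p ω) w (rootedParents G r w))
    (k : ∀ u : rootedParents G r w, I u) :
    moment μ (fun ω => condProb (p ω) w (rootedParents G r w) k) =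
      dirichletMoment fun l =>
        familyTable (fun i => κ⁻¹ * ∫ ω, p ω i ∂μ) w (rootedParents G r w) (k, l) := by
  have := Classical.nonempty_pi.1 ‹Nonempty (∀ v, I v)›
  have hw := notMem_rootedParents_self (G := G) r w
  rw [(polyaRecursion_condProb hp hG hind h k).eq_dirichletMoment hκ
    (fun l => (hp.familyTable hw).integral_pos (k, l)) (hp.condProb hw k).isSimplexMoments.zero]
  congr with l
  rw [familyTable, pushforward, ← Finset.mul_sum]
  exact congrArg (κ⁻¹ * ·) (hp.integral_pushforward _ (k, l))

end HyperDirichlet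

end GraphDirichlet

theorem mainTheorem6 {V : Type*} [Fintype V] [DecidableEq V]
    (hV : 2 ≤ Fintype.card V)
    (G : SimpleGraph V) [DecidableRel G.Adj] (hG : G.IsTree)
    {I : V → Type*} [∀ v, Fintype (I v)] [∀ v, DecidableEq (I v)]
    {Ω : Type*} [MeasurableSpace Ω] (μ : MeasureTheory.Measure Ω)
    [MeasureTheory.IsProbabilityMeasure μ]
    (p : Ω → (∀ v, I v) → ℝ)
    (hp : GraphDirichlet.IsAssociated G μ p)
    (hind : ∀ v : V, G.degree v = 1 →
      GraphDirichlet.ParameterIndependence μ p (GraphDirichlet.rootedParents G v)) :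
    GraphDirichlet.FollowsHyperDirichlet G μ p := by
  open GraphDirichlet in
  have : Nontrivial V := Fintype.one_lt_card_iff_nontrivial.1 hV
  obtain ⟨ρ, hρ⟩ := hG.exists_vert_degree_one_of_nontrivial
  have ⟨hprob, K, C, hC, hassoc⟩ := hp
  have hX : IsRandomSimplex μ p := ⟨hprob.measurable, hprob.pos, hprob.sum_eq_one⟩
  have := hX.nonempty
  obtain ⟨κ, hκ, hfamily⟩ := exists_forall_hasPolyaMoments_familyTable hX hG hind
  have ha (i : ∀ v, I v) : 0 < κ⁻¹ * ∫ ω, p ω i ∂μ :=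
    mul_pos (inv_pos.2 hκ) (hX.integral_pos i)
  refine ⟨hp, K, C, hC, marginal fun i => κ⁻¹ * ∫ ω, p ω i ∂μ, isHyperparameter_marginal ha C,
    fun r => ?_⟩
  rw [normConst_div_normConst_eq_prod_dirichletMoment ha hG hC ρ,
    integral_prod_pow_eq_prod_moment hX hG hC hassoc (hind ρ hρ).1]
  simp only [moment_condProb_eq_dirichletMoment hX hG (hind ρ hρ).1 hκ (hfamily ρ _)]
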